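/- **Conventions.** All tensor products of C\*-algebras are spatial (minimal). Let $\mathcal{A}$ be a unital C\*-algebra. A representation $\pi:\mathcal{A}\to\mathbf{L}(\mathcal{H})$ on a Hilbert space is called *atomic* if it is the Hilbert space direct sum of a family of pairwise inequivalent irreducible representations. Let $\pi$ be a faithful atomic representation, regard $\mathcal{A}$ as a subalgebra of $\mathbf{L}(\mathcal{H})$ and $\mathcal{A}\otimes\mathcal{A}$ as a subalgebra of $\mathbf{L}(\mathcal{H}\bar\otimes\mathcal{H})$, and let $\mathcal{A}''=\pi(\mathcal{A})''$. Let $P_\delta$ be the supremum of all projections $p\otimes p$ with $p$ a minimal projection of $\mathcal{A}''$, and let $\mathcal{H}_\delta\subseteq\mathcal{H}\bar\otimes\mathcal{H}$ be its range. A *quantum metric* with respect to $\pi$ is an element $\rho\in\mathcal{A}\otimes\mathcal{A}$ such that 1. $\rho\ge 0$; 2. $\rho P_\delta=P_\delta\rho=0$; 3. $0$ is not an eigenvalue of the restriction of $\rho$ to $\mathcal{H}_\delta^\perp$; 4. $\mathfrak{F}(\rho)=\rho$, where $\mathfrak{F}$ is the flip $a\otimes b\mapsto b\otimes a$; 5.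 $\mathfrak{M}(\rho)\le\rho\otimes 1+1\otimes\rho$ in $\mathcal{A}\otimes\mathcal{A}\otimes\mathcal{A}$, where $\mathfrak{M}$ is the \*-morphism $a\otimes b\mapsto a\otimes 1\otimes b$. In this case $(\mathcal{A},\rho,\pi)$ is called a *compact quantum metric space*. **Theorem.** Let $(\mathcal{A}_1,\rho_1,\pi_1)$ and $(\mathcal{A}_2,\rho_2,\pi_2)$ be compact quantum metric spaces and let $r>0$ be a real number with $r\ge\frac12\max(\|\rho_1\|,\|\rho_2\|)$. Then $(\mathcal{A}_1\oplus\mathcal{A}_2,\rho,\pi_1\oplus\pi_2)$ is a compact quantum metric space, where $$\rho=\rho_1+\rho_2+r\,1_{\mathcal{A}_1\otimes\mathcal{A}_2}+r\,1_{\mathcal{A}_2\otimes\mathcal{A}_1}\in\bigoplus_{i,j=1,2}\mathcal{A}_i\otimes\mathcal{A}_j=(\mathcal{A}_1\oplus\mathcal{A}_2)\otimes(\mathcal{A}_1\oplus\mathcal{A}_2).$$ -/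

import Mathlib

open scoped TensorProduct
open UniformSpace (Completion)

noncomputable section

namespace QuantumMetric

/-! ### Hilbert space tensor products and tensor products of operators -/

section Tensor

variable {H K L M : Type*}
  [NormedAddCommGroup H] [InnerProductSpace ℂ H]
  [NormedAddCommGroup K] [InnerProductSpace ℂ K]
  [NormedAddCommGroup L] [InnerProductSpace ℂ L]
  [NormedAddCommGroup M] [InnerProductSpace ℂ M]

/-- The Hilbert space tensor product: the completion of the algebraic tensor product with respect
to the inner product `⟪x ⊗ y, x' ⊗ y'⟫ = ⟪x, x'⟫ * ⟪y, y'⟫`. -/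
def HTensor (H K : Type*) [NormedAddCommGroup H] [InnerProductSpace ℂ H]
    [NormedAddCommGroup K] [InnerProductSpace ℂ K] : Type _ :=
  Completion (H ⊗[ℂ] K)

instance : NormedAddCommGroup (HTensor H K) :=
  inferInstanceAs (NormedAddCommGroup (Completion (H ⊗[ℂ] K)))

instance : InnerProductSpace ℂ (HTensor H K) :=
  inferInstanceAs (InnerProductSpace ℂ (Completion (H ⊗[ℂ] K)))

instance : CompleteSpace (HTensor H K) :=
  inferInstanceAs (CompleteSpace (Completion (H ⊗[ℂ] K)))

/-- The isometric inclusion of the algebraic tensor product. -/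
def incl (H K : Type*) [NormedAddCommGroup H] [InnerProductSpace ℂ H]
    [NormedAddCommGroup K] [InnerProductSpace ℂ K] : H ⊗[ℂ] K →ₗᵢ[ℂ] HTensor H K :=
  Completion.toComplₗᵢ

theorem denseRange_incl : DenseRange (incl H K) :=
  Completion.denseRange_coe (α := H ⊗[ℂ] K)

/-- The elementary tensor `x ⊗ y` in the Hilbert space tensor product. -/
def htmul (x : H) (y : K) : HTensor H K := incl H K (x ⊗ₜ[ℂ] y)

/-- The tensor product `S ⊗ T` of two bounded operators, acting on the Hilbert space tensor
product: the continuous extension of the algebraic tensor product of the operators. -/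
def opTensor (S : H →L[ℂ] L) (T : K →L[ℂ] M) : HTensor H K →L[ℂ] HTensor L M :=
  ((incl L M).toLinearMap ∘ₗ TensorProduct.map S.toLinearMap T.toLinearMap).extendOfNorm
    (incl H K).toLinearMap

theorem opTensor_htmul (S : H →L[ℂ] L) (T : K →L[ℂ] M) (x : H) (y : K) :
    opTensor S T (htmul x y) = htmul (S x) (T y) :=
  LinearMap.extendOfNorm_eq (e := (incl H K).toLinearMap) denseRange_incl
    ⟨‖TensorProduct.mapL S T‖, fun t => by
      have h := (TensorProduct.mapL S T).le_opNorm t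
      rw [TensorProduct.mapL_apply] at h
      simpa using h⟩ (x ⊗ₜ[ℂ] y)

/-- A closed subspace containing `x ⊗ y` for all `x, y` is everything. -/
theorem eq_top_of_htmul_mem {S : Submodule ℂ (HTensor H K)}
    (hS : IsClosed (S : Set (HTensor H K))) (h : ∀ x y, htmul x y ∈ S) : S = ⊤ := by
  rw [eq_top_iff]
  rintro z -
  refine denseRange_incl.induction_on (p := fun z => z ∈ S) z hS fun t => ?_
  induction t using TensorProduct.induction_on with
  | zero => rw [map_zero]; exact S.zero_mem
  | tmul x y => exact h x y
  | add a b ha hb => rw [map_add]; exact S.add_mem ha hb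

/-- Two bounded operators on `H ⊗ K` which agree on elementary tensors are equal. -/
theorem ext_htmul {F : Type*} [NormedAddCommGroup F] [NormedSpace ℂ F]
    {S T : HTensor H K →L[ℂ] F} (h : ∀ x y, S (htmul x y) = T (htmul x y)) : S = T := by
  have := eq_top_of_htmul_mem (S := LinearMap.eqLocus S.toLinearMap T.toLinearMap)
    (isClosed_eq S.continuous T.continuous) h
  ext z
  have hz : z ∈ LinearMap.eqLocus S.toLinearMap T.toLinearMap := by rw [this]; trivial
  exact hz

theorem inner_htmul (x x' : H) (y y' : K) :
    inner ℂ (htmul x y) (htmul x' y') = inner ℂ x x' * inner ℂ y y' := by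
  rw [htmul, htmul, LinearIsometry.inner_map_map, TensorProduct.inner_tmul]

theorem opTensor_mul (S S' : H →L[ℂ] H) (T T' : K →L[ℂ] K) :
    opTensor (S * S') (T * T') = opTensor S T * opTensor S' T' :=
  ext_htmul fun x y => by simp [opTensor_htmul]

theorem opTensor_one : opTensor (1 : H →L[ℂ] H) (1 : K →L[ℂ] K) = 1 :=
  ext_htmul fun x y => by simp [opTensor_htmul]

theorem adjoint_opTensor [CompleteSpace H] [CompleteSpace K] [CompleteSpace L] [CompleteSpace M]
    (S : H →L[ℂ] L) (T : K →L[ℂ] M) :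
    (opTensor S T).adjoint = opTensor S.adjoint T.adjoint := by
  have key : ∀ (v : L) (w : M), innerSL ℂ ((opTensor S T).adjoint (htmul v w)) =
      innerSL ℂ (opTensor S.adjoint T.adjoint (htmul v w)) := fun v w =>
    ext_htmul fun x y => by
      simp [opTensor_htmul, inner_htmul, ContinuousLinearMap.adjoint_inner_left]
  refine ext_htmul fun v w => ?_
  refine ext_inner_right ℂ fun z => ?_
  exact congrArg (fun f => f z) (key v w)

/-- The unitary `H ⊗ K → K ⊗ H`, `x ⊗ y ↦ y ⊗ x`. -/
def hflip (H K : Type*) [NormedAddCommGroup H] [InnerProductSpace ℂ H]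
    [NormedAddCommGroup K] [InnerProductSpace ℂ K] : HTensor H K ≃ₗᵢ[ℂ] HTensor K H :=
  (TensorProduct.comm ℂ H K).extendOfIsometry
    (incl H K).toLinearMap (incl K H).toLinearMap denseRange_incl denseRange_incl
    (fun x => by simp)

theorem hflip_htmul (x : H) (y : K) : hflip H K (htmul x y) = htmul y x :=
  LinearEquiv.extendOfIsometry_eq (TensorProduct.comm ℂ H K)
    (incl H K).toLinearMap (incl K H).toLinearMap denseRange_incl denseRange_incl
    (fun x => by simp) (x ⊗ₜ[ℂ] y)

/-- The isometric inclusion of the algebraic tensor product in `(H ⊗ K) ⊗ L`. -/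
def inclLeft (H K L : Type*) [NormedAddCommGroup H] [InnerProductSpace ℂ H]
    [NormedAddCommGroup K] [InnerProductSpace ℂ K]
    [NormedAddCommGroup L] [InnerProductSpace ℂ L] :
    (H ⊗[ℂ] K) ⊗[ℂ] L →ₗᵢ[ℂ] HTensor (HTensor H K) L :=
  (incl (HTensor H K) L).comp (LinearIsometry.rTensor L (incl H K))

/-- The isometric inclusion of the algebraic tensor product in `H ⊗ (K ⊗ L)`. -/
def inclRight (H K L : Type*) [NormedAddCommGroup H] [InnerProductSpace ℂ H]
    [NormedAddCommGroup K] [InnerProductSpace ℂ K]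
    [NormedAddCommGroup L] [InnerProductSpace ℂ L] :
    H ⊗[ℂ] (K ⊗[ℂ] L) →ₗᵢ[ℂ] HTensor H (HTensor K L) :=
  (incl H (HTensor K L)).comp (LinearIsometry.lTensor H (incl K L))

theorem inclLeft_tmul (x : H) (y : K) (z : L) :
    inclLeft H K L ((x ⊗ₜ[ℂ] y) ⊗ₜ[ℂ] z) = htmul (htmul x y) z := rfl

theorem inclRight_tmul (x : H) (y : K) (z : L) :
    inclRight H K L (x ⊗ₜ[ℂ] (y ⊗ₜ[ℂ] z)) = htmul x (htmul y z) := rfl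

theorem continuous_htmul : Continuous fun p : H × K => htmul p.1 p.2 :=
  (incl H K).continuous.comp TensorProduct.continuous_tmul

theorem denseRange_inclLeft : DenseRange (inclLeft H K L) := by
  have h := eq_top_of_htmul_mem
    (S := (LinearMap.range (inclLeft H K L).toLinearMap).topologicalClosure)
    (Submodule.isClosed_topologicalClosure _) (fun u z =>
      denseRange_incl.induction_on u
        ((Submodule.isClosed_topologicalClosure _).preimage
          (continuous_htmul.comp (continuous_id.prodMk continuous_const)))
        fun t => Submodule.le_topologicalClosure _ ⟨t ⊗ₜ[ℂ] z, rfl⟩)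
  exact fun z => by
    have : z ∈ (LinearMap.range (inclLeft H K L).toLinearMap).topologicalClosure := by
      rw [h]; trivial
    exact this

theorem denseRange_inclRight : DenseRange (inclRight H K L) := by
  have h := eq_top_of_htmul_mem
    (S := (LinearMap.range (inclRight H K L).toLinearMap).topologicalClosure)
    (Submodule.isClosed_topologicalClosure _) (fun x u =>
      denseRange_incl.induction_on u
        ((Submodule.isClosed_topologicalClosure _).preimage
          (continuous_htmul.comp (continuous_const.prodMk continuous_id)))
        fun t => Submodule.le_topologicalClosure _ ⟨x ⊗ₜ[ℂ] t, rfl⟩)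
  exact fun z => by
    have : z ∈ (LinearMap.range (inclRight H K L).toLinearMap).topologicalClosure := by
      rw [h]; trivial
    exact this

/-- A unitary between algebraic triple tensor products extends to their completions. -/
def tripleExtend {H' K' L' : Type*} [NormedAddCommGroup H'] [InnerProductSpace ℂ H']
    [NormedAddCommGroup K'] [InnerProductSpace ℂ K']
    [NormedAddCommGroup L'] [InnerProductSpace ℂ L']
    (e : (H ⊗[ℂ] K) ⊗[ℂ] L ≃ₗᵢ[ℂ] H' ⊗[ℂ] (K' ⊗[ℂ] L')) :
    HTensor (HTensor H K) L ≃ₗᵢ[ℂ] HTensor H' (HTensor K' L') :=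
  e.toLinearEquiv.extendOfIsometry
    (inclLeft H K L).toLinearMap (inclRight H' K' L').toLinearMap
    denseRange_inclLeft denseRange_inclRight
    (fun x => ((inclRight H' K' L').norm_map _).trans
      ((e.norm_map x).trans ((inclLeft H K L).norm_map x).symm))

theorem tripleExtend_inclLeft {H' K' L' : Type*} [NormedAddCommGroup H'] [InnerProductSpace ℂ H']
    [NormedAddCommGroup K'] [InnerProductSpace ℂ K']
    [NormedAddCommGroup L'] [InnerProductSpace ℂ L']
    (e : (H ⊗[ℂ] K) ⊗[ℂ] L ≃ₗᵢ[ℂ] H' ⊗[ℂ] (K' ⊗[ℂ] L')) (t : (H ⊗[ℂ] K) ⊗[ℂ] L) :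
    tripleExtend e (inclLeft H K L t) = inclRight H' K' L' (e t) :=
  LinearEquiv.extendOfIsometry_eq e.toLinearEquiv
    (inclLeft H K L).toLinearMap (inclRight H' K' L').toLinearMap
    denseRange_inclLeft denseRange_inclRight
    (fun x => ((inclRight H' K' L').norm_map _).trans
      ((e.norm_map x).trans ((inclLeft H K L).norm_map x).symm)) t

/-- The unitary `(H ⊗ K) ⊗ L → H ⊗ (K ⊗ L)`, `(x ⊗ y) ⊗ z ↦ x ⊗ (y ⊗ z)`. -/
def hassoc (H K L : Type*) [NormedAddCommGroup H] [InnerProductSpace ℂ H]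
    [NormedAddCommGroup K] [InnerProductSpace ℂ K]
    [NormedAddCommGroup L] [InnerProductSpace ℂ L] :
    HTensor (HTensor H K) L ≃ₗᵢ[ℂ] HTensor H (HTensor K L) :=
  tripleExtend (TensorProduct.assocIsometry ℂ H K L)

theorem hassoc_htmul (x : H) (y : K) (z : L) :
    hassoc H K L (htmul (htmul x y) z) = htmul x (htmul y z) :=
  tripleExtend_inclLeft _ ((x ⊗ₜ[ℂ] y) ⊗ₜ[ℂ] z)

theorem hassoc_symm_htmul (x : H) (y : K) (z : L) :
    (hassoc H K L).symm (htmul x (htmul y z)) = htmul (htmul x y) z := by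
  rw [LinearIsometryEquiv.symm_apply_eq, hassoc_htmul]

/-- The unitary `(H ⊗ L) ⊗ K → H ⊗ (K ⊗ L)`, `(x ⊗ z) ⊗ y ↦ x ⊗ (y ⊗ z)`. -/
def hmid (H K L : Type*) [NormedAddCommGroup H] [InnerProductSpace ℂ H]
    [NormedAddCommGroup K] [InnerProductSpace ℂ K]
    [NormedAddCommGroup L] [InnerProductSpace ℂ L] :
    HTensor (HTensor H L) K ≃ₗᵢ[ℂ] HTensor H (HTensor K L) :=
  tripleExtend ((TensorProduct.assocIsometry ℂ H L K).trans
    (LinearIsometryEquiv.lTensor H (TensorProduct.commIsometry ℂ L K)))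

theorem hmid_htmul (x : H) (y : K) (z : L) :
    hmid H K L (htmul (htmul x z) y) = htmul x (htmul y z) :=
  tripleExtend_inclLeft _ ((x ⊗ₜ[ℂ] z) ⊗ₜ[ℂ] y)

theorem hmid_symm_htmul (x : H) (y : K) (z : L) :
    (hmid H K L).symm (htmul x (htmul y z)) = htmul (htmul x z) y := by
  rw [LinearIsometryEquiv.symm_apply_eq, hmid_htmul]

/-- Two bounded operators on `H ⊗ (K ⊗ L)` which agree on elementary tensors are equal. -/
theorem ext_htmul₃ {F : Type*} [NormedAddCommGroup F] [NormedSpace ℂ F]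
    {S T : HTensor H (HTensor K L) →L[ℂ] F}
    (h : ∀ x y z, S (htmul x (htmul y z)) = T (htmul x (htmul y z))) : S = T := by
  refine ext_htmul fun x u => ?_
  have hc : Continuous fun u : HTensor K L => htmul x u :=
    continuous_htmul.comp (continuous_const.prodMk continuous_id)
  refine denseRange_incl.induction_on (p := fun u => S (htmul x u) = T (htmul x u)) u
    (isClosed_eq (S.continuous.comp hc) (T.continuous.comp hc)) fun t => ?_
  induction t using TensorProduct.induction_on with
  | zero => simp [htmul]
  | tmul y z => exact h x y z
  | add a b ha hb =>
    have e : htmul x (incl K L (a + b)) = htmul x (incl K L a) + htmul x (incl K L b) := by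
      simp only [htmul, map_add, TensorProduct.tmul_add]
    rw [e, map_add, map_add, ha, hb]

end Tensor

/-! ### The flip, the leg operators, and the morphism `a ⊗ b ↦ a ⊗ 1 ⊗ b` -/

section Legs

variable {H : Type*} [NormedAddCommGroup H] [InnerProductSpace ℂ H] [CompleteSpace H]

/-- The flip morphism `a ⊗ b ↦ b ⊗ a`. -/
def flip : (HTensor H H →L[ℂ] HTensor H H) ≃⋆ₐ[ℂ] (HTensor H H →L[ℂ] HTensor H H) :=
  (hflip H H).conjStarAlgEquiv

theorem flip_opTensor (S T : H →L[ℂ] H) : flip (opTensor S T) = opTensor T S := by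
  refine ext_htmul fun x y => ?_
  have h : (hflip H H).symm (htmul x y) = htmul y x := by
    rw [LinearIsometryEquiv.symm_apply_eq, hflip_htmul]
  simp [flip, h, opTensor_htmul, hflip_htmul]

theorem htmul_add_left {K : Type*} [NormedAddCommGroup K] [InnerProductSpace ℂ K]
    (x x' : H) (y : K) : htmul (x + x') y = htmul x y + htmul x' y := by
  simp only [htmul, map_add, TensorProduct.add_tmul]

theorem htmul_smul_left {K : Type*} [NormedAddCommGroup K] [InnerProductSpace ℂ K]
    (c : ℂ) (x : H) (y : K) : htmul (c • x) y = c • htmul x y := by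
  rw [htmul, ← TensorProduct.smul_tmul', map_smul]; rfl

theorem opTensor_add_one {K : Type*} [NormedAddCommGroup K] [InnerProductSpace ℂ K]
    (S T : H →L[ℂ] H) :
    opTensor (S + T) (1 : K →L[ℂ] K) = opTensor S 1 + opTensor T 1 :=
  ext_htmul fun x y => by
    simp [opTensor_htmul, htmul_add_left]

theorem opTensor_smul_one {K : Type*} [NormedAddCommGroup K] [InnerProductSpace ℂ K]
    (c : ℂ) (S : H →L[ℂ] H) :
    opTensor (c • S) (1 : K →L[ℂ] K) = c • opTensor S 1 :=
  ext_htmul fun x y => by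
    simp [opTensor_htmul, htmul_smul_left]

/-- The *-morphism `S ↦ S ⊗ 1`. -/
def ampliation (H K : Type*) [NormedAddCommGroup H] [InnerProductSpace ℂ H] [CompleteSpace H]
    [NormedAddCommGroup K] [InnerProductSpace ℂ K] [CompleteSpace K] :
    (H →L[ℂ] H) →⋆ₐ[ℂ] (HTensor H K →L[ℂ] HTensor H K) where
  toFun S := opTensor S 1
  map_one' := opTensor_one
  map_mul' S T := by rw [← opTensor_mul, one_mul]
  map_zero' := by simpa using opTensor_smul_one (K := K) 0 (0 : H →L[ℂ] H)
  map_add' S T := opTensor_add_one S T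
  commutes' c := by
    rw [Algebra.algebraMap_eq_smul_one, opTensor_smul_one, opTensor_one,
      Algebra.algebraMap_eq_smul_one]
  map_star' S := by
    rw [ContinuousLinearMap.star_eq_adjoint, ContinuousLinearMap.star_eq_adjoint,
      adjoint_opTensor]
    congr 1
    exact (star_one (K →L[ℂ] K)).symm

/-- The element `ρ ⊗ 1`, acting on the triple tensor product `H ⊗ (H ⊗ H)`. -/
def rightOne (ρ : HTensor H H →L[ℂ] HTensor H H) :
    HTensor H (HTensor H H) →L[ℂ] HTensor H (HTensor H H) :=
  (hassoc H H H).conjStarAlgEquiv (opTensor ρ 1)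

/-- The element `1 ⊗ ρ`, acting on the triple tensor product `H ⊗ (H ⊗ H)`. -/
def leftOne (ρ : HTensor H H →L[ℂ] HTensor H H) :
    HTensor H (HTensor H H) →L[ℂ] HTensor H (HTensor H H) :=
  opTensor 1 ρ

/-- The *-morphism that puts `1` in the mid position, `a ⊗ b ↦ a ⊗ 1 ⊗ b`. -/
def midOne : (HTensor H H →L[ℂ] HTensor H H) →⋆ₐ[ℂ]
    (HTensor H (HTensor H H) →L[ℂ] HTensor H (HTensor H H)) :=
  (StarAlgHomClass.toStarAlgHom (hmid H H H).conjStarAlgEquiv).comp (ampliation (HTensor H H) H)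

theorem rightOne_opTensor (S T : H →L[ℂ] H) :
    rightOne (opTensor S T) = opTensor S (opTensor T 1) :=
  ext_htmul₃ fun x y z => by
    simp [rightOne, hassoc_symm_htmul, opTensor_htmul, hassoc_htmul]

theorem midOne_opTensor (S T : H →L[ℂ] H) :
    midOne (opTensor S T) = opTensor S (opTensor 1 T) :=
  ext_htmul₃ fun x y z => by
    change hmid H H H (opTensor (opTensor S T) 1 ((hmid H H H).symm _)) = _
    simp [hmid_symm_htmul, opTensor_htmul, hmid_htmul]

end Legs

/-! ### Representations -/

section Rep

variable {A H : Type*} [CStarAlgebra A]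
  [NormedAddCommGroup H] [InnerProductSpace ℂ H] [CompleteSpace H]

/-- The subspace `V` of `H` is invariant under the representation `π`. -/
def IsInvariant (π : A →⋆ₐ[ℂ] (H →L[ℂ] H)) (V : Submodule ℂ H) : Prop :=
  ∀ a, ∀ x ∈ V, π a x ∈ V

/-- The subspace `V` is closed and invariant under `π`, and the representation obtained by restricting
`π` to `V` is irreducible. -/
structure IsIrreducibleSub (π : A →⋆ₐ[ℂ] (H →L[ℂ] H)) (V : Submodule ℂ H) : Prop where
  isClosed : IsClosed (V : Set H)
  invariant : IsInvariant π V
  ne_bot : V ≠ ⊥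
  irreducible : ∀ W : Submodule ℂ H, IsClosed (W : Set H) → IsInvariant π W → W ≤ V →
    W = ⊥ ∨ W = V

/-- The restrictions of `π` to the invariant subspaces `V` and `W` are unitarily equivalent. -/
def EquivalentSub (π : A →⋆ₐ[ℂ] (H →L[ℂ] H)) (V W : Submodule ℂ H) : Prop :=
  ∃ U : V ≃ₗᵢ[ℂ] W, ∀ (a : A) (x y : V), (y : H) = π a x → (U y : H) = π a (U x)

/-- `π` is atomic: it is the Hilbert space direct sum of a family of pairwise inequivalent
irreducible representations. -/
def IsAtomic.{u, v} {A : Type u} {H : Type v} [CStarAlgebra A]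
    [NormedAddCommGroup H] [InnerProductSpace ℂ H] [CompleteSpace H]
    (π : A →⋆ₐ[ℂ] (H →L[ℂ] H)) : Prop :=
  ∃ (ι : Type v) (V : ι → Submodule ℂ H),
    IsHilbertSum ℂ (fun i => V i) (fun i => (V i).subtypeₗᵢ) ∧
    (∀ i, IsIrreducibleSub π (V i)) ∧
    Pairwise fun i j => ¬ EquivalentSub π (V i) (V j)

/-- The enveloping von Neumann algebra: the double commutant of `π(A)`. -/
def envelope (π : A →⋆ₐ[ℂ] (H →L[ℂ] H)) : Set (H →L[ℂ] H) :=
  Set.centralizer (Set.centralizer (Set.range π))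

/-- `p` is a minimal projection of the enveloping von Neumann algebra of `π`. -/
structure IsMinimalProjection (π : A →⋆ₐ[ℂ] (H →L[ℂ] H)) (p : H →L[ℂ] H) : Prop where
  isStarProjection : IsStarProjection p
  mem : p ∈ envelope π
  ne_zero : p ≠ 0
  minimal : ∀ q ∈ envelope π, IsStarProjection q → q ≤ p → q = 0 ∨ q = p

/-- The range of the characteristic function of the diagonal: the closed linear span of the ranges
of the projections `p ⊗ p`, where `p` is a minimal projection of the enveloping algebra. -/
def diagSubspace (π : A →⋆ₐ[ℂ] (H →L[ℂ] H)) : Submodule ℂ (HTensor H H) :=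
  (⨆ (p : H →L[ℂ] H) (_ : IsMinimalProjection π p), (opTensor p p).range).topologicalClosure

instance (π : A →⋆ₐ[ℂ] (H →L[ℂ] H)) : CompleteSpace (diagSubspace π) :=
  (Submodule.isClosed_topologicalClosure _).completeSpace_coe

/-- The characteristic function of the diagonal `P_δ`: the supremum of all projections `p ⊗ p`
with `p` a minimal projection of the enveloping algebra. -/
def diagProj (π : A →⋆ₐ[ℂ] (H →L[ℂ] H)) : HTensor H H →L[ℂ] HTensor H H :=
  (diagSubspace π).starProjection

/-- `P_δ` is indeed the least projection that dominates all `p ⊗ p`. -/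
theorem diagProj_isLeast (π : A →⋆ₐ[ℂ] (H →L[ℂ] H)) :
    IsLeast {Q : HTensor H H →L[ℂ] HTensor H H | IsStarProjection Q ∧
      ∀ p, IsMinimalProjection π p → opTensor p p ≤ Q} (diagProj π) := by
  have hpp : ∀ p, IsMinimalProjection π p → IsStarProjection (opTensor p p) := fun p hp => by
    refine ⟨?_, ?_⟩
    · rw [IsIdempotentElem, ← opTensor_mul, hp.isStarProjection.isIdempotentElem.eq]
    · have h := hp.isStarProjection.isSelfAdjoint
      rw [ContinuousLinearMap.isSelfAdjoint_iff'] at h ⊢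
      rw [adjoint_opTensor, h]
  refine ⟨⟨isStarProjection_starProjection, fun p hp => ?_⟩, ?_⟩
  · obtain ⟨h1, h2⟩ := isStarProjection_iff_eq_starProjection_range.1 (hpp p hp)
    rw [h2, diagProj, Submodule.starProjection_le_starProjection_iff]
    exact (le_iSup₂ (f := fun (p : H →L[ℂ] H) (_ : IsMinimalProjection π p) =>
      (opTensor p p).range) p hp).trans (Submodule.le_topologicalClosure _)
  · rintro Q ⟨hQ, hle⟩
    obtain ⟨h1, h2⟩ := isStarProjection_iff_eq_starProjection_range.1 hQ
    rw [h2, diagProj, Submodule.starProjection_le_starProjection_iff]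
    refine Submodule.topologicalClosure_minimal _ (iSup₂_le fun p hp => ?_) ?_
    · obtain ⟨h3, h4⟩ :=
        isStarProjection_iff_eq_starProjection_range.1 (hpp p hp)
      have := hle p hp
      rwa [h2, h4, Submodule.starProjection_le_starProjection_iff] at this
    · exact ContinuousLinearMap.IsIdempotentElem.isClosed_range hQ.isIdempotentElem

/-- The spatial tensor product, realised through the representations `π₁` and `π₂`: the norm
closed *-algebra generated by the operators `π₁ a ⊗ π₂ b`. (For faithful representations this is
the spatial tensor product of the two C*-algebras.) -/
def spatialTensor {A₁ A₂ H₁ H₂ : Type*} [CStarAlgebra A₁] [CStarAlgebra A₂]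
    [NormedAddCommGroup H₁] [InnerProductSpace ℂ H₁] [CompleteSpace H₁]
    [NormedAddCommGroup H₂] [InnerProductSpace ℂ H₂] [CompleteSpace H₂]
    (π₁ : A₁ →⋆ₐ[ℂ] (H₁ →L[ℂ] H₁)) (π₂ : A₂ →⋆ₐ[ℂ] (H₂ →L[ℂ] H₂)) :
    StarSubalgebra ℂ (HTensor H₁ H₂ →L[ℂ] HTensor H₁ H₂) :=
  (StarAlgebra.adjoin ℂ {T | ∃ a b, T = opTensor (π₁ a) (π₂ b)}).topologicalClosure

/-- `ρ` is a (compatible) quantum metric with respect to `π`. -/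
structure IsQuantumMetric (π : A →⋆ₐ[ℂ] (H →L[ℂ] H)) (ρ : HTensor H H →L[ℂ] HTensor H H) :
    Prop where
  mem : ρ ∈ spatialTensor π π
  /-- Positivity, in the order of positive operators. -/
  nonneg : 0 ≤ ρ
  mul_diag : ρ * diagProj π = 0
  diag_mul : diagProj π * ρ = 0
  /-- `0` is not an eigenvalue of the restriction of `ρ` to the orthogonal complement of the range
  of `P_δ`. -/
  eq_zero_of_apply_eq_zero : ∀ x ∈ (diagSubspace π)ᗮ, ρ x = 0 → x = 0
  flip_eq : flip ρ = ρ
  triangle : midOne ρ ≤ rightOne ρ + leftOne ρ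

/-- `(A, ρ, π)` is a compact quantum metric space. -/
structure IsCompactQuantumMetricSpace (A : Type*) {H : Type*} [CStarAlgebra A]
    [NormedAddCommGroup H] [InnerProductSpace ℂ H] [CompleteSpace H]
    (ρ : HTensor H H →L[ℂ] HTensor H H) (π : A →⋆ₐ[ℂ] (H →L[ℂ] H)) : Prop where
  faithful : Function.Injective π
  atomic : IsAtomic π
  isQuantumMetric : IsQuantumMetric π ρ

end Rep

/-! ### Direct sums -/

section DirectSum

variable {A₁ A₂ H₁ H₂ : Type*} [CStarAlgebra A₁] [CStarAlgebra A₂]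
  [NormedAddCommGroup H₁] [InnerProductSpace ℂ H₁] [CompleteSpace H₁]
  [NormedAddCommGroup H₂] [InnerProductSpace ℂ H₂] [CompleteSpace H₂]

/-- The Hilbert space direct sum. -/
abbrev HSum (H₁ H₂ : Type*) [NormedAddCommGroup H₁] [InnerProductSpace ℂ H₁]
    [NormedAddCommGroup H₂] [InnerProductSpace ℂ H₂] : Type _ :=
  WithLp 2 (H₁ × H₂)

/-- The direct sum `S ⊕ T` of two bounded operators. -/
def opSum (S : H₁ →L[ℂ] H₁) (T : H₂ →L[ℂ] H₂) : HSum H₁ H₂ →L[ℂ] HSum H₁ H₂ :=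
  (WithLp.prodContinuousLinearEquiv 2 ℂ H₁ H₂).symm.toContinuousLinearMap ∘L
    S.prodMap T ∘L (WithLp.prodContinuousLinearEquiv 2 ℂ H₁ H₂).toContinuousLinearMap

theorem opSum_apply (S : H₁ →L[ℂ] H₁) (T : H₂ →L[ℂ] H₂) (x : HSum H₁ H₂) :
    opSum S T x = WithLp.toLp 2 (S x.fst, T x.snd) := rfl

/-- The direct sum `π₁ ⊕ π₂` of two representations, a representation of `A₁ ⊕ A₂`. -/
def repSum (π₁ : A₁ →⋆ₐ[ℂ] (H₁ →L[ℂ] H₁)) (π₂ : A₂ →⋆ₐ[ℂ] (H₂ →L[ℂ] H₂)) :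
    A₁ × A₂ →⋆ₐ[ℂ] (HSum H₁ H₂ →L[ℂ] HSum H₁ H₂) where
  toFun a := opSum (π₁ a.1) (π₂ a.2)
  map_one' := by ext x; apply WithLp.ofLp_injective; simp [opSum_apply]; rfl
  map_mul' a b := by ext x; apply WithLp.ofLp_injective; simp [opSum_apply]
  map_zero' := by ext x; apply WithLp.ofLp_injective; simp [opSum_apply]
  map_add' a b := by ext x; apply WithLp.ofLp_injective; simp [opSum_apply]
  commutes' c := by
    ext x
    apply WithLp.ofLp_injective
    simp [opSum_apply, Algebra.algebraMap_eq_smul_one]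
    rfl
  map_star' a := by
    rw [ContinuousLinearMap.star_eq_adjoint, ContinuousLinearMap.eq_adjoint_iff]
    intro x y
    simp [opSum_apply, map_star, ContinuousLinearMap.star_eq_adjoint,
      ContinuousLinearMap.adjoint_inner_left]

/-- The isometric inclusion of the first summand. -/
def inl (H₁ H₂ : Type*) [NormedAddCommGroup H₁] [InnerProductSpace ℂ H₁]
    [NormedAddCommGroup H₂] [InnerProductSpace ℂ H₂] : H₁ →L[ℂ] HSum H₁ H₂ :=
  (WithLp.prodContinuousLinearEquiv 2 ℂ H₁ H₂).symm.toContinuousLinearMap ∘L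
    ContinuousLinearMap.inl ℂ H₁ H₂

/-- The isometric inclusion of the second summand. -/
def inr (H₁ H₂ : Type*) [NormedAddCommGroup H₁] [InnerProductSpace ℂ H₁]
    [NormedAddCommGroup H₂] [InnerProductSpace ℂ H₂] : H₂ →L[ℂ] HSum H₁ H₂ :=
  (WithLp.prodContinuousLinearEquiv 2 ℂ H₁ H₂).symm.toContinuousLinearMap ∘L
    ContinuousLinearMap.inr ℂ H₁ H₂

/-- For an isometry `V : H → K`, the (non-unital) inclusion `ρ ↦ (V ⊗ V) ρ (V ⊗ V)*` of the
operators on `H ⊗ H` in those on `K ⊗ K`. -/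
def corner {H K : Type*} [NormedAddCommGroup H] [InnerProductSpace ℂ H] [CompleteSpace H]
    [NormedAddCommGroup K] [InnerProductSpace ℂ K] [CompleteSpace K]
    (V : H →L[ℂ] K) (ρ : HTensor H H →L[ℂ] HTensor H H) : HTensor K K →L[ℂ] HTensor K K :=
  opTensor V V ∘L ρ ∘L (opTensor V V).adjoint

theorem adjoint_inl_apply (x : HSum H₁ H₂) : (inl H₁ H₂).adjoint x = x.fst := by
  refine ext_inner_right ℂ fun y => ?_
  rw [ContinuousLinearMap.adjoint_inner_left]
  simp [inl]

theorem adjoint_inr_apply (x : HSum H₁ H₂) : (inr H₁ H₂).adjoint x = x.snd := by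
  refine ext_inner_right ℂ fun y => ?_
  rw [ContinuousLinearMap.adjoint_inner_left]
  simp [inr]

/-- On elementary tensors, `corner` is the inclusion of `A₁ ⊗ A₁` in `(A₁ ⊕ A₂) ⊗ (A₁ ⊕ A₂)`. -/
theorem corner_inl_opTensor (π₁ : A₁ →⋆ₐ[ℂ] (H₁ →L[ℂ] H₁)) (π₂ : A₂ →⋆ₐ[ℂ] (H₂ →L[ℂ] H₂))
    (a b : A₁) : corner (inl H₁ H₂) (opTensor (π₁ a) (π₁ b)) =
      opTensor (repSum π₁ π₂ (a, 0)) (repSum π₁ π₂ (b, 0)) := by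
  refine ext_htmul fun x y => ?_
  have h : ∀ c : A₁, ∀ z : HSum H₁ H₂,
      repSum π₁ π₂ (c, 0) z = inl H₁ H₂ (π₁ c z.fst) := fun c z => by
    change opSum (π₁ c) (π₂ 0) z = _
    simp [opSum_apply, inl]
  simp [corner, adjoint_opTensor, opTensor_htmul, adjoint_inl_apply, h]

/-- On elementary tensors, `corner` is the inclusion of `A₂ ⊗ A₂` in `(A₁ ⊕ A₂) ⊗ (A₁ ⊕ A₂)`. -/
theorem corner_inr_opTensor (π₁ : A₁ →⋆ₐ[ℂ] (H₁ →L[ℂ] H₁)) (π₂ : A₂ →⋆ₐ[ℂ] (H₂ →L[ℂ] H₂))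
    (a b : A₂) : corner (inr H₁ H₂) (opTensor (π₂ a) (π₂ b)) =
      opTensor (repSum π₁ π₂ (0, a)) (repSum π₁ π₂ (0, b)) := by
  refine ext_htmul fun x y => ?_
  have h : ∀ c : A₂, ∀ z : HSum H₁ H₂,
      repSum π₁ π₂ (0, c) z = inr H₁ H₂ (π₂ c z.snd) := fun c z => by
    change opSum (π₁ 0) (π₂ c) z = _
    simp [opSum_apply, inr]
  simp [corner, adjoint_opTensor, opTensor_htmul, adjoint_inr_apply, h]

/-- The element `ρ₁ + ρ₂ + r 1_{A₁ ⊗ A₂} + r 1_{A₂ ⊗ A₁}` of `(A₁ ⊕ A₂) ⊗ (A₁ ⊕ A₂)`. -/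
def sumMetric (π₁ : A₁ →⋆ₐ[ℂ] (H₁ →L[ℂ] H₁)) (π₂ : A₂ →⋆ₐ[ℂ] (H₂ →L[ℂ] H₂))
    (ρ₁ : HTensor H₁ H₁ →L[ℂ] HTensor H₁ H₁) (ρ₂ : HTensor H₂ H₂ →L[ℂ] HTensor H₂ H₂) (r : ℝ) :
    HTensor (HSum H₁ H₂) (HSum H₁ H₂) →L[ℂ] HTensor (HSum H₁ H₂) (HSum H₁ H₂) :=
  corner (inl H₁ H₂) ρ₁ + corner (inr H₁ H₂) ρ₂
    + (r : ℂ) • opTensor (repSum π₁ π₂ (1, 0)) (repSum π₁ π₂ (0, 1))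
    + (r : ℂ) • opTensor (repSum π₁ π₂ (0, 1)) (repSum π₁ π₂ (1, 0))

end DirectSum

end QuantumMetric

end

/-! Let `V` and `W` be the inclusions of the two summands of `K`, with range projections `e`, `f`.
With respect to `e ⊗ e`, `f ⊗ f`, `e ⊗ f`, `f ⊗ e` the glued operator is diagonal, with blocks
`ρ₁`, `ρ₂`, `r`, `r`. Each minimal projection of the enveloping von Neumann algebra of `K` lies
under `e` or under `f`, so the diagonal of `K ⊗ K` lives in the first two blocks and the kernel
can be read off blockwise. The triangle inequality says that a defect, linear in the metric, is
positive. On the pure corners `e ⊗ e ⊗ e` and `f ⊗ f ⊗ f` this is the hypothesis. On the corners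
with two factors `e` and one factor `f` the off-diagonal part of the metric adds either `0` or
`2r` to the defect, the latter exactly where `ρ₁` enters negatively, and `ρ₁ ≤ ‖ρ₁‖ ≤ 2r`;
likewise for `ρ₂`. -/

noncomputable section

namespace QuantumMetric

open ContinuousLinearMap
open scoped InnerProduct

section OpTensor

variable {H K L M : Type*}
  [NormedAddCommGroup H] [InnerProductSpace ℂ H]
  [NormedAddCommGroup K] [InnerProductSpace ℂ K]
  [NormedAddCommGroup L] [InnerProductSpace ℂ L]
  [NormedAddCommGroup M] [InnerProductSpace ℂ M]

/-- The tensor product of operators as a bilinear map, which carries the linearity of `opTensor`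
in either argument. -/
def opTensorₗ : (H →L[ℂ] L) →ₗ[ℂ] (K →L[ℂ] M) →ₗ[ℂ] (HTensor H K →L[ℂ] HTensor L M) :=
  LinearMap.mk₂ ℂ opTensor
    (fun S S' T => ext_htmul fun x y => by
      simp only [add_apply, opTensor_htmul]
      simp only [htmul, TensorProduct.add_tmul, map_add])
    (fun c S T => ext_htmul fun x y => by
      simp only [smul_apply, opTensor_htmul]
      simp only [htmul, ← TensorProduct.smul_tmul', map_smul])
    (fun S T T' => ext_htmul fun x y => by
      simp only [add_apply, opTensor_htmul]
      simp only [htmul, TensorProduct.tmul_add, map_add])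
    (fun c S T => ext_htmul fun x y => by
      simp only [smul_apply, opTensor_htmul]
      simp only [htmul, TensorProduct.tmul_smul, map_smul])

theorem opTensor_zero_left (T : K →L[ℂ] M) : opTensor (0 : H →L[ℂ] L) T = 0 :=
  LinearMap.map_zero₂ opTensorₗ T

theorem opTensor_zero_right (S : H →L[ℂ] L) : opTensor S (0 : K →L[ℂ] M) = 0 :=
  map_zero (opTensorₗ S)

theorem opTensor_add_left (S S' : H →L[ℂ] L) (T : K →L[ℂ] M) :
    opTensor (S + S') T = opTensor S T + opTensor S' T :=
  LinearMap.map_add₂ opTensorₗ S S' T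

theorem opTensor_add_right (S : H →L[ℂ] L) (T T' : K →L[ℂ] M) :
    opTensor S (T + T') = opTensor S T + opTensor S T' :=
  map_add (opTensorₗ S) T T'

theorem opTensor_comp {H' K' : Type*} [NormedAddCommGroup H'] [InnerProductSpace ℂ H']
    [NormedAddCommGroup K'] [InnerProductSpace ℂ K']
    (S : H →L[ℂ] L) (S' : H' →L[ℂ] H) (T : K →L[ℂ] M) (T' : K' →L[ℂ] K) :
    opTensor (S ∘L S') (T ∘L T') = opTensor S T ∘L opTensor S' T' :=
  ext_htmul fun x y => by simp [opTensor_htmul]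

end OpTensor

section ConjAdjoint

variable {H K L M : Type*}
  [NormedAddCommGroup H] [InnerProductSpace ℂ H] [CompleteSpace H]
  [NormedAddCommGroup K] [InnerProductSpace ℂ K] [CompleteSpace K]
  [NormedAddCommGroup L] [InnerProductSpace ℂ L] [CompleteSpace L]
  [NormedAddCommGroup M] [InnerProductSpace ℂ M] [CompleteSpace M]

/-- The conjugation `T ↦ V T V†` by a bounded operator `V : H → K`. For an isometry `V` it embeds
the operators on `H` as the corner `V V† L(K) V V†` of the operators on `K`. -/
def conjAdjoint (V : H →L[ℂ] K) : (H →L[ℂ] H) →ₗ[ℂ] (K →L[ℂ] K) where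
  toFun T := V ∘L T ∘L V†
  map_add' S T := by simp [add_comp, comp_add]
  map_smul' c T := by simp

theorem conjAdjoint_apply (V : H →L[ℂ] K) (T : H →L[ℂ] H) : conjAdjoint V T = V ∘L T ∘L V† := rfl

theorem conjAdjoint_one (V : H →L[ℂ] K) : conjAdjoint V 1 = V ∘L V† := rfl

theorem continuous_conjAdjoint (V : H →L[ℂ] K) : Continuous (conjAdjoint V) :=
  continuous_const.clm_comp (continuous_id.clm_comp continuous_const)

theorem star_conjAdjoint (V : H →L[ℂ] K) (T : H →L[ℂ] H) :
    star (conjAdjoint V T) = conjAdjoint V (star T) := by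
  simp only [conjAdjoint_apply, star_eq_adjoint, adjoint_comp, adjoint_adjoint, comp_assoc]

theorem conjAdjoint_nonneg (V : H →L[ℂ] K) {T : H →L[ℂ] H} (hT : 0 ≤ T) : 0 ≤ conjAdjoint V T := by
  rw [nonneg_iff_isPositive] at hT ⊢
  exact hT.conj_adjoint V

theorem comp_adjoint_nonneg (V : H →L[ℂ] K) : 0 ≤ V ∘L V† :=
  (nonneg_iff_isPositive _).2 (isPositive_self_comp_adjoint V)

theorem conjAdjoint_mono (V : H →L[ℂ] K) : Monotone (conjAdjoint V) := fun S T h => by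
  rw [← sub_nonneg] at h ⊢
  simpa only [map_sub] using conjAdjoint_nonneg V h

theorem opTensor_conjAdjoint (V : H →L[ℂ] K) (W : L →L[ℂ] M) (S : H →L[ℂ] H) (T : L →L[ℂ] L) :
    opTensor (conjAdjoint V S) (conjAdjoint W T) = conjAdjoint (opTensor V W) (opTensor S T) := by
  simp only [conjAdjoint_apply, opTensor_comp, adjoint_opTensor]

theorem opTensor_nonneg {S : H →L[ℂ] H} {T : K →L[ℂ] K} (hS : 0 ≤ S) (hT : 0 ≤ T) :
    0 ≤ opTensor S T := by
  obtain ⟨s, rfl⟩ := CStarAlgebra.nonneg_iff_eq_mul_star_self.1 hS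
  obtain ⟨t, rfl⟩ := CStarAlgebra.nonneg_iff_eq_mul_star_self.1 hT
  have h := conjAdjoint_nonneg (opTensor s t) zero_le_one
  rwa [← opTensor_one, ← opTensor_conjAdjoint] at h

theorem conjStarAlgEquiv_conjAdjoint {U : H →L[ℂ] L} {U' : K →L[ℂ] M} (e : H ≃ₗᵢ[ℂ] K)
    (e' : L ≃ₗᵢ[ℂ] M) (h : ∀ y, U (e.symm y) = e'.symm (U' y)) (T : H →L[ℂ] H) :
    e'.conjStarAlgEquiv (conjAdjoint U T) = conjAdjoint U' (e.conjStarAlgEquiv T) := by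
  have hU (x : H) : e' (U x) = U' (e x) := by
    rw [← e'.eq_symm_apply, ← h, e.symm_apply_apply]
  have hadj (z : M) : (U†) (e'.symm z) = e.symm ((U'†) z) := by
    refine ext_inner_right ℂ fun x => ?_
    rw [adjoint_inner_left, ← e'.inner_map_map, ← e.inner_map_map, hU, e'.apply_symm_apply,
      e.apply_symm_apply, adjoint_inner_left]
  ext z
  simp only [LinearIsometryEquiv.conjStarAlgEquiv_apply_apply, conjAdjoint_apply, comp_apply,
    hadj, hU]

section Isometry

variable {V : H →L[ℂ] K} (hV : V† ∘L V = 1)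

include hV

theorem conjAdjoint_mul (S T : H →L[ℂ] H) :
    conjAdjoint V S * conjAdjoint V T = conjAdjoint V (S * T) := by
  have h (x : H) : (V†) (V x) = x := congr($hV x)
  ext x
  simp [conjAdjoint_apply, h]

theorem conjAdjoint_adjoint_conjAdjoint (T : H →L[ℂ] H) :
    conjAdjoint (V†) (conjAdjoint V T) = T := by
  have h (x : H) : (V†) (V x) = x := congr($hV x)
  ext x
  simp [conjAdjoint_apply, h]

theorem conjAdjoint_injective : Function.Injective (conjAdjoint V) :=
  Function.LeftInverse.injective (conjAdjoint_adjoint_conjAdjoint hV)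

theorem conjAdjoint_le_conjAdjoint_iff {S T : H →L[ℂ] H} :
    conjAdjoint V S ≤ conjAdjoint V T ↔ S ≤ T := by
  refine ⟨fun h => ?_, fun h => conjAdjoint_mono V h⟩
  simpa only [conjAdjoint_adjoint_conjAdjoint hV] using conjAdjoint_mono (V†) h

theorem isStarProjection_conjAdjoint_iff {p : H →L[ℂ] H} :
    IsStarProjection (conjAdjoint V p) ↔ IsStarProjection p := by
  simp only [isStarProjection_iff, IsIdempotentElem, isSelfAdjoint_iff, conjAdjoint_mul hV,
    star_conjAdjoint, (conjAdjoint_injective hV).eq_iff]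

theorem conjAdjoint_one_mul_conjAdjoint (T : H →L[ℂ] H) :
    (V ∘L V†) * conjAdjoint V T = conjAdjoint V T := by
  rw [← conjAdjoint_one, conjAdjoint_mul hV, one_mul]

theorem conjAdjoint_mul_conjAdjoint_one (T : H →L[ℂ] H) :
    conjAdjoint V T * (V ∘L V†) = conjAdjoint V T := by
  rw [← conjAdjoint_one, conjAdjoint_mul hV, mul_one]

theorem isStarProjection_comp_adjoint : IsStarProjection (V ∘L V†) :=
  (isStarProjection_conjAdjoint_iff hV).2 (.one _)

theorem exists_eq_conjAdjoint_of_le {p : H →L[ℂ] H} {q : K →L[ℂ] K}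
    (hp : IsStarProjection p) (hq : IsStarProjection q) (h : q ≤ conjAdjoint V p) :
    ∃ q', q = conjAdjoint V q' := by
  have hp' := (isStarProjection_conjAdjoint_iff hV).2 hp
  have hleft : conjAdjoint V p * q = q := (hq.le_iff_mul_eq_right hp').1 h
  have hright : q * conjAdjoint V p = q := (hq.le_iff_mul_eq_left hp').1 h
  refine ⟨p ∘L conjAdjoint (V†) q ∘L p, ?_⟩
  calc q = conjAdjoint V p * q * conjAdjoint V p := by rw [hleft, hright]
    _ = conjAdjoint V (p ∘L conjAdjoint (V†) q ∘L p) := by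
      simp only [conjAdjoint_apply, adjoint_adjoint, mul_def, comp_assoc]

end Isometry

end ConjAdjoint

section Naturality

variable {H H' K K' L L' : Type*}
  [NormedAddCommGroup H] [InnerProductSpace ℂ H] [NormedAddCommGroup H'] [InnerProductSpace ℂ H']
  [NormedAddCommGroup K] [InnerProductSpace ℂ K] [NormedAddCommGroup K'] [InnerProductSpace ℂ K']
  [NormedAddCommGroup L] [InnerProductSpace ℂ L] [NormedAddCommGroup L'] [InnerProductSpace ℂ L']

theorem opTensor_hflip_symm (S : H →L[ℂ] H') (T : K →L[ℂ] K') (u : HTensor K H) :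
    opTensor S T ((hflip H K).symm u) = (hflip H' K').symm (opTensor T S u) := by
  have h : opTensor S T ∘L ((hflip H K).symm.toContinuousLinearEquiv : _ →L[ℂ] _) =
      ((hflip H' K').symm.toContinuousLinearEquiv : _ →L[ℂ] _) ∘L opTensor T S :=
    ext_htmul fun x y => by
      simp [opTensor_htmul, (LinearIsometryEquiv.symm_apply_eq _).2 (hflip_htmul _ _).symm]
  exact congr($h u)

theorem opTensor_hassoc_symm (S : H →L[ℂ] H') (T : K →L[ℂ] K') (U : L →L[ℂ] L')
    (u : HTensor H (HTensor K L)) :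
    opTensor (opTensor S T) U ((hassoc H K L).symm u) =
      (hassoc H' K' L').symm (opTensor S (opTensor T U) u) := by
  have h : opTensor (opTensor S T) U ∘L
      ((hassoc H K L).symm.toContinuousLinearEquiv : _ →L[ℂ] _) =
        ((hassoc H' K' L').symm.toContinuousLinearEquiv : _ →L[ℂ] _) ∘L
          opTensor S (opTensor T U) :=
    ext_htmul₃ fun x y z => by simp [opTensor_htmul, hassoc_symm_htmul]
  exact congr($h u)

theorem opTensor_hmid_symm (S : H →L[ℂ] H') (T : K →L[ℂ] K') (U : L →L[ℂ] L')
    (u : HTensor H (HTensor K L)) :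
    opTensor (opTensor S U) T ((hmid H K L).symm u) =
      (hmid H' K' L').symm (opTensor S (opTensor T U) u) := by
  have h : opTensor (opTensor S U) T ∘L
      ((hmid H K L).symm.toContinuousLinearEquiv : _ →L[ℂ] _) =
        ((hmid H' K' L').symm.toContinuousLinearEquiv : _ →L[ℂ] _) ∘L
          opTensor S (opTensor T U) :=
    ext_htmul₃ fun x y z => by simp [opTensor_htmul, hmid_symm_htmul]
  exact congr($h u)

end Naturality

section TriangleDefect

variable {H K : Type*}
  [NormedAddCommGroup H] [InnerProductSpace ℂ H]
  [NormedAddCommGroup K] [InnerProductSpace ℂ K]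

/-- The operator `X₁₂ a₃` on `H ⊗ (H ⊗ H)`, with `X` acting on the first two legs and `a` on the
third one, as a bilinear map. -/
def leg₁₂ : (HTensor H H →L[ℂ] HTensor H H) →ₗ[ℂ] (H →L[ℂ] H) →ₗ[ℂ]
    (HTensor H (HTensor H H) →L[ℂ] HTensor H (HTensor H H)) :=
  opTensorₗ.compr₂ (LinearMapClass.linearMap (hassoc H H H).conjStarAlgEquiv)

/-- The operator `X₁₃ a₂` on `H ⊗ (H ⊗ H)`, with `X` acting on the outer two legs and `a` on the
middle one, as a bilinear map. -/
def leg₁₃ : (HTensor H H →L[ℂ] HTensor H H) →ₗ[ℂ] (H →L[ℂ] H) →ₗ[ℂ]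
    (HTensor H (HTensor H H) →L[ℂ] HTensor H (HTensor H H)) :=
  opTensorₗ.compr₂ (LinearMapClass.linearMap (hmid H H H).conjStarAlgEquiv)

/-- The defect `X₁₂ a₃ + a₁ X₂₃ - X₁₃ a₂` of the triangle inequality for `X`, with `a` acting on
the leg that `X` leaves alone. The triangle inequality is the case `a = 1`; the extra argument
allows one to split it along a decomposition of `1`. -/
def triangleDefect : (HTensor H H →L[ℂ] HTensor H H) →ₗ[ℂ] (H →L[ℂ] H) →ₗ[ℂ]
    (HTensor H (HTensor H H) →L[ℂ] HTensor H (HTensor H H)) :=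
  leg₁₂ + opTensorₗ.flip - leg₁₃

theorem leg₁₂_apply (X : HTensor H H →L[ℂ] HTensor H H) (a : H →L[ℂ] H) :
    leg₁₂ X a = (hassoc H H H).conjStarAlgEquiv (opTensor X a) := rfl

theorem leg₁₃_apply (X : HTensor H H →L[ℂ] HTensor H H) (a : H →L[ℂ] H) :
    leg₁₃ X a = (hmid H H H).conjStarAlgEquiv (opTensor X a) := rfl

theorem triangleDefect_apply (X : HTensor H H →L[ℂ] HTensor H H) (a : H →L[ℂ] H) :
    triangleDefect X a = leg₁₂ X a + opTensor a X - leg₁₃ X a := rfl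

theorem leg₁₂_opTensor (S T a : H →L[ℂ] H) :
    leg₁₂ (opTensor S T) a = opTensor S (opTensor T a) :=
  ext_htmul₃ fun x y z => by
    simp [leg₁₂_apply, hassoc_symm_htmul, opTensor_htmul, hassoc_htmul]

theorem leg₁₃_opTensor (S T a : H →L[ℂ] H) :
    leg₁₃ (opTensor S T) a = opTensor S (opTensor a T) :=
  ext_htmul₃ fun x y z => by
    simp [leg₁₃_apply, hmid_symm_htmul, opTensor_htmul, hmid_htmul]

theorem triangleDefect_opTensor_add (e f : H →L[ℂ] H) :
    triangleDefect (opTensor e f) (e + f) =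
      opTensor e (opTensor f e) + opTensor f (opTensor e f) := by
  simp only [triangleDefect_apply, map_add, leg₁₂_opTensor, leg₁₃_opTensor]
  abel

variable [CompleteSpace H] [CompleteSpace K]

theorem midOne_le_iff_triangleDefect_nonneg {ρ : HTensor H H →L[ℂ] HTensor H H} :
    midOne ρ ≤ rightOne ρ + leftOne ρ ↔ 0 ≤ triangleDefect ρ 1 :=
  sub_nonneg.symm

theorem leg₁₂_nonneg {X : HTensor H H →L[ℂ] HTensor H H} {a : H →L[ℂ] H} (hX : 0 ≤ X)
    (ha : 0 ≤ a) : 0 ≤ leg₁₂ X a :=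
  map_nonneg (hassoc H H H).conjStarAlgEquiv (opTensor_nonneg hX ha)

theorem leg₁₃_nonneg {X : HTensor H H →L[ℂ] HTensor H H} {a : H →L[ℂ] H} (hX : 0 ≤ X)
    (ha : 0 ≤ a) : 0 ≤ leg₁₃ X a :=
  map_nonneg (hmid H H H).conjStarAlgEquiv (opTensor_nonneg hX ha)

theorem corner_eq_conjAdjoint (V : H →L[ℂ] K) (ρ : HTensor H H →L[ℂ] HTensor H H) :
    corner V ρ = conjAdjoint (opTensor V V) ρ := rfl

theorem corner_nonneg (V : H →L[ℂ] K) {ρ : HTensor H H →L[ℂ] HTensor H H} (hρ : 0 ≤ ρ) :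
    0 ≤ corner V ρ :=
  conjAdjoint_nonneg _ hρ

theorem flip_corner (V : H →L[ℂ] K) (ρ : HTensor H H →L[ℂ] HTensor H H) :
    flip (corner V ρ) = corner V (flip ρ) :=
  conjStarAlgEquiv_conjAdjoint _ _ (opTensor_hflip_symm V V) ρ

theorem triangleDefect_corner (V : H →L[ℂ] K) (ρ : HTensor H H →L[ℂ] HTensor H H)
    (a : H →L[ℂ] H) :
    triangleDefect (corner V ρ) (conjAdjoint V a) =
      conjAdjoint (opTensor V (opTensor V V)) (triangleDefect ρ a) := by
  simp only [triangleDefect_apply, leg₁₂_apply, leg₁₃_apply, corner_eq_conjAdjoint,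
    opTensor_conjAdjoint, map_add, map_sub,
    conjStarAlgEquiv_conjAdjoint _ _ (opTensor_hassoc_symm V V V),
    conjStarAlgEquiv_conjAdjoint _ _ (opTensor_hmid_symm V V V)]

theorem triangleDefect_corner_nonneg (V : H →L[ℂ] K) {ρ : HTensor H H →L[ℂ] HTensor H H}
    (hρ : 0 ≤ triangleDefect ρ 1) : 0 ≤ triangleDefect (corner V ρ) (V ∘L V†) := by
  rw [← conjAdjoint_one, triangleDefect_corner]
  exact conjAdjoint_nonneg _ hρ

theorem triangleDefect_add_leg₁₃_nonneg {X Y : HTensor H H →L[ℂ] HTensor H H} {a : H →L[ℂ] H}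
    (hX : 0 ≤ X) (hXY : X ≤ Y) (ha : 0 ≤ a) : 0 ≤ triangleDefect X a + leg₁₃ Y a := by
  have h : triangleDefect X a + leg₁₃ Y a = leg₁₂ X a + opTensor a X + leg₁₃ (Y - X) a := by
    rw [triangleDefect_apply, LinearMap.map_sub₂]
    abel
  rw [h]
  exact add_nonneg (add_nonneg (leg₁₂_nonneg hX ha) (opTensor_nonneg ha hX))
    (leg₁₃_nonneg (sub_nonneg.2 hXY) ha)

theorem corner_le_smul_opTensor (V : H →L[ℂ] K) {ρ : HTensor H H →L[ℂ] HTensor H H} {c : ℝ}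
    (hρ : IsSelfAdjoint ρ) (hc : ‖ρ‖ ≤ c) :
    corner V ρ ≤ (c : ℂ) • opTensor (V ∘L V†) (V ∘L V†) := by
  have h : ρ ≤ (c : ℂ) • opTensor 1 1 := by
    rw [opTensor_one, ← Algebra.algebraMap_eq_smul_one]
    exact hρ.le_algebraMap_norm_self.trans (algebraMap_mono _ hc)
  simpa only [corner_eq_conjAdjoint, map_smul, ← opTensor_conjAdjoint, conjAdjoint_one]
    using conjAdjoint_mono (opTensor V V) h

end TriangleDefect

section Glue

variable {H₁ H₂ K : Type*}
  [NormedAddCommGroup H₁] [InnerProductSpace ℂ H₁] [CompleteSpace H₁]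
  [NormedAddCommGroup H₂] [InnerProductSpace ℂ H₂] [CompleteSpace H₂]
  [NormedAddCommGroup K] [InnerProductSpace ℂ K] [CompleteSpace K]

/-- The isometries `V` and `W` exhibit `K` as the orthogonal direct sum of `H₁` and `H₂`. -/
structure IsSplitting (V : H₁ →L[ℂ] K) (W : H₂ →L[ℂ] K) : Prop where
  isometry_left : V† ∘L V = 1
  isometry_right : W† ∘L W = 1
  add_eq_one : V ∘L V† + W ∘L W† = 1

/-- The metric on a disjoint union: `ρ₁` and `ρ₂` on the two pieces, and distance `r` between points
of different pieces. -/
def glue (V : H₁ →L[ℂ] K) (W : H₂ →L[ℂ] K) (ρ₁ : HTensor H₁ H₁ →L[ℂ] HTensor H₁ H₁)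
    (ρ₂ : HTensor H₂ H₂ →L[ℂ] HTensor H₂ H₂) (r : ℝ) : HTensor K K →L[ℂ] HTensor K K :=
  corner V ρ₁ + corner W ρ₂ + (r : ℂ) • opTensor (V ∘L V†) (W ∘L W†)
    + (r : ℂ) • opTensor (W ∘L W†) (V ∘L V†)

variable {V : H₁ →L[ℂ] K} {W : H₂ →L[ℂ] K} {ρ₁ : HTensor H₁ H₁ →L[ℂ] HTensor H₁ H₁}
  {ρ₂ : HTensor H₂ H₂ →L[ℂ] HTensor H₂ H₂} {r : ℝ}

theorem glue_comm : glue V W ρ₁ ρ₂ r = glue W V ρ₂ ρ₁ r := by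
  simp only [glue]
  abel

open scoped ComplexOrder in
theorem glue_nonneg (h₁ : 0 ≤ ρ₁) (h₂ : 0 ≤ ρ₂) (hr : 0 ≤ r) : 0 ≤ glue V W ρ₁ ρ₂ r := by
  have hr' : (0 : ℂ) ≤ r := Complex.zero_le_real.2 hr
  have hV := comp_adjoint_nonneg V
  have hW := comp_adjoint_nonneg W
  rw [glue]
  exact add_nonneg (add_nonneg (add_nonneg (corner_nonneg V h₁) (corner_nonneg W h₂))
    (smul_nonneg hr' (opTensor_nonneg hV hW))) (smul_nonneg hr' (opTensor_nonneg hW hV))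

theorem flip_glue (h₁ : flip ρ₁ = ρ₁) (h₂ : flip ρ₂ = ρ₂) :
    flip (glue V W ρ₁ ρ₂ r) = glue V W ρ₁ ρ₂ r := by
  simp only [glue, map_add, map_smul, flip_corner, flip_opTensor, h₁, h₂]
  abel

namespace IsSplitting

variable (h : IsSplitting V W)

include h

theorem symm : IsSplitting W V :=
  ⟨h.isometry_right, h.isometry_left, by rw [add_comm, h.add_eq_one]⟩

theorem adjoint_comp_eq_zero : V† ∘L W = 0 := by
  have h' : V† ∘L (V ∘L V† + W ∘L W†) ∘L W = V† ∘L W + V† ∘L W := by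
    rw [add_comp, comp_add, comp_assoc W, h.isometry_right, comp_assoc V, ← comp_assoc (V†),
      h.isometry_left]
    rfl
  rw [h.add_eq_one] at h'
  exact left_eq_add.1 h'

theorem adjoint_opTensor_left_comp_glue :
    (opTensor V V)† ∘L glue V W ρ₁ ρ₂ r = ρ₁ ∘L (opTensor V V)† := by
  simp only [glue, corner, adjoint_opTensor, comp_add, comp_smul, ← comp_assoc, ← opTensor_comp,
    h.isometry_left, h.adjoint_comp_eq_zero, zero_comp, opTensor_zero_left, opTensor_zero_right,
    opTensor_one, smul_zero, add_zero]
  rfl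

theorem adjoint_opTensor_mixed_comp_glue :
    (opTensor V W)† ∘L glue V W ρ₁ ρ₂ r = (r : ℂ) • (opTensor V W)† := by
  simp only [glue, corner, adjoint_opTensor, comp_add, comp_smul, ← comp_assoc, ← opTensor_comp,
    h.isometry_left, h.isometry_right, h.adjoint_comp_eq_zero, h.symm.adjoint_comp_eq_zero,
    zero_comp, opTensor_zero_left, opTensor_zero_right, smul_zero, add_zero, zero_add]
  rfl

theorem glue_comp_opTensor_left (hρ₁ : 0 ≤ ρ₁) (hρ₂ : 0 ≤ ρ₂) (hr : 0 ≤ r) :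
    glue V W ρ₁ ρ₂ r ∘L opTensor V V = opTensor V V ∘L ρ₁ := by
  have hadj := congrArg adjoint (h.adjoint_opTensor_left_comp_glue (ρ₁ := ρ₁) (ρ₂ := ρ₂) (r := r))
  rwa [adjoint_comp, adjoint_comp, adjoint_adjoint, (IsSelfAdjoint.of_nonneg hρ₁).adjoint_eq,
    (IsSelfAdjoint.of_nonneg (glue_nonneg hρ₁ hρ₂ hr)).adjoint_eq] at hadj

theorem eq_zero_of_adjoint_opTensor_apply_eq_zero {x : HTensor K K}
    (hVV : ((opTensor V V)†) x = 0) (hVW : ((opTensor V W)†) x = 0)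
    (hWV : ((opTensor W V)†) x = 0) (hWW : ((opTensor W W)†) x = 0) : x = 0 := by
  have hsum : (1 : HTensor K K →L[ℂ] HTensor K K) =
      conjAdjoint (opTensor V V) 1 + conjAdjoint (opTensor V W) 1 +
        (conjAdjoint (opTensor W V) 1 + conjAdjoint (opTensor W W) 1) := by
    simp only [← opTensor_one, ← opTensor_conjAdjoint, ← opTensor_add_left, ← opTensor_add_right,
      conjAdjoint_one, h.add_eq_one]
  calc x = (1 : HTensor K K →L[ℂ] HTensor K K) x := rfl
    _ = 0 := by
      simp only [hsum, conjAdjoint_one, add_apply, comp_apply, hVV, hVW, hWV, hWW, map_zero,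
        add_zero]

theorem triangleDefect_glue_one :
    triangleDefect (glue V W ρ₁ ρ₂ r) 1 =
      triangleDefect (corner V ρ₁) (V ∘L V†) + triangleDefect (corner W ρ₂) (W ∘L W†) +
      (triangleDefect (corner V ρ₁) (W ∘L W†) +
        leg₁₃ (((2 * r : ℝ) : ℂ) • opTensor (V ∘L V†) (V ∘L V†)) (W ∘L W†)) +
      (triangleDefect (corner W ρ₂) (V ∘L V†) +
        leg₁₃ (((2 * r : ℝ) : ℂ) • opTensor (W ∘L W†) (W ∘L W†)) (V ∘L V†)) := by
  have hVW := triangleDefect_opTensor_add (V ∘L V†) (W ∘L W†)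
  have hWV := triangleDefect_opTensor_add (W ∘L W†) (V ∘L V†)
  rw [← h.add_eq_one, glue]
  simp only [map_add, map_smul, LinearMap.add_apply, LinearMap.smul_apply, leg₁₃_opTensor,
    Complex.ofReal_mul, Complex.ofReal_ofNat] at hVW hWV ⊢
  linear_combination (norm := module) (r : ℂ) • hVW + (r : ℂ) • hWV

theorem midOne_glue_le (hρ₁ : 0 ≤ ρ₁) (hρ₂ : 0 ≤ ρ₂)
    (ht₁ : midOne ρ₁ ≤ rightOne ρ₁ + leftOne ρ₁) (ht₂ : midOne ρ₂ ≤ rightOne ρ₂ + leftOne ρ₂)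
    (hr₁ : ‖ρ₁‖ ≤ 2 * r) (hr₂ : ‖ρ₂‖ ≤ 2 * r) :
    midOne (glue V W ρ₁ ρ₂ r) ≤
      rightOne (glue V W ρ₁ ρ₂ r) + leftOne (glue V W ρ₁ ρ₂ r) := by
  rw [midOne_le_iff_triangleDefect_nonneg] at ht₁ ht₂ ⊢
  have hV := comp_adjoint_nonneg V
  have hW := comp_adjoint_nonneg W
  have hVVW := triangleDefect_add_leg₁₃_nonneg (corner_nonneg V hρ₁)
    (corner_le_smul_opTensor V (.of_nonneg hρ₁) hr₁) hW
  have hWWV := triangleDefect_add_leg₁₃_nonneg (corner_nonneg W hρ₂)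
    (corner_le_smul_opTensor W (.of_nonneg hρ₂) hr₂) hV
  rw [h.triangleDefect_glue_one]
  exact add_nonneg (add_nonneg (add_nonneg (triangleDefect_corner_nonneg V ht₁)
    (triangleDefect_corner_nonneg W ht₂)) hVVW) hWWV

end IsSplitting

end Glue

section Diagonal

variable {A H : Type*} [CStarAlgebra A]
  [NormedAddCommGroup H] [InnerProductSpace ℂ H] [CompleteSpace H] {π : A →⋆ₐ[ℂ] (H →L[ℂ] H)}

theorem diagSubspace_le_iff {S : Submodule ℂ (HTensor H H)}
    (hS : IsClosed (S : Set (HTensor H H))) :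
    diagSubspace π ≤ S ↔ ∀ p, IsMinimalProjection π p → (opTensor p p).range ≤ S := by
  rw [← iSup₂_le_iff]
  exact ⟨(Submodule.le_topologicalClosure _).trans,
    fun h => Submodule.topologicalClosure_minimal _ h hS⟩

theorem mul_diagProj_eq_zero_iff {T : HTensor H H →L[ℂ] HTensor H H} :
    T * diagProj π = 0 ↔ ∀ p, IsMinimalProjection π p → T ∘L opTensor p p = 0 := by
  have hcomp (S : HTensor H H →L[ℂ] HTensor H H) : T ∘L S = 0 ↔ S.range ≤ T.ker := by
    rw [LinearMap.range_le_ker_iff, ← toLinearMap_comp, ← toLinearMap_zero, coe_inj]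
  rw [mul_def, hcomp, diagProj, Submodule.range_starProjection, diagSubspace_le_iff T.isClosed_ker]
  simp only [hcomp]

theorem mem_orthogonal_diagSubspace_iff {x : HTensor H H} :
    x ∈ (diagSubspace π)ᗮ ↔ ∀ p, IsMinimalProjection π p → opTensor p p x = 0 := by
  have hx (S : Submodule ℂ (HTensor H H)) : x ∈ Sᗮ ↔ S ≤ (ℂ ∙ x)ᗮ := by
    rw [← Submodule.span_singleton_le_iff_mem]
    exact Submodule.isOrtho_comm
  rw [hx, diagSubspace_le_iff (Submodule.isClosed_orthogonal _)]
  refine forall₂_congr fun p hp => ?_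
  rw [← hx, orthogonal_range, adjoint_opTensor, hp.isStarProjection.isSelfAdjoint.adjoint_eq]
  rfl

theorem opTensor_mem_spatialTensor {B K : Type*} [CStarAlgebra B] [NormedAddCommGroup K]
    [InnerProductSpace ℂ K] [CompleteSpace K] (π : A →⋆ₐ[ℂ] (H →L[ℂ] H))
    (σ : B →⋆ₐ[ℂ] (K →L[ℂ] K)) (a : A) (b : B) :
    opTensor (π a) (σ b) ∈ spatialTensor π σ :=
  StarSubalgebra.le_topologicalClosure _ (StarAlgebra.subset_adjoin ℂ _ ⟨a, b, rfl⟩)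

end Diagonal

section Summand

variable {A B H K : Type*} [CStarAlgebra A] [CStarAlgebra B]
  [NormedAddCommGroup H] [InnerProductSpace ℂ H] [CompleteSpace H]
  [NormedAddCommGroup K] [InnerProductSpace ℂ K] [CompleteSpace K]

/-- The isometry `V` exhibits `π` as a direct summand of the representation `σ`, up to the choice
of the acting algebra: `σ` restricts to `π` on the range of `V`, and the image of `σ` contains the
operators of `π` extended by zero, in particular the projection onto the range of `V`. -/
structure IsSummand (σ : B →⋆ₐ[ℂ] (K →L[ℂ] K)) (V : H →L[ℂ] K) (π : A →⋆ₐ[ℂ] (H →L[ℂ] H)) :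
    Prop where
  isometry : V† ∘L V = 1
  exists_eq_conjAdjoint : ∀ a, ∃ b, σ b = conjAdjoint V (π a)
  exists_comp_eq : ∀ b, ∃ a, σ b ∘L V = V ∘L π a

variable {σ : B →⋆ₐ[ℂ] (K →L[ℂ] K)} {V : H →L[ℂ] K} {π : A →⋆ₐ[ℂ] (H →L[ℂ] H)}

namespace IsSummand

variable (h : IsSummand σ V π)

include h

theorem exists_eq_comp_adjoint : ∃ b, σ b = V ∘L V† := by
  simpa only [map_one, conjAdjoint_one] using h.exists_eq_conjAdjoint 1

theorem exists_comp_eq_comp (a : A) : ∃ b, σ b ∘L V = V ∘L π a := by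
  obtain ⟨b, hb⟩ := h.exists_eq_conjAdjoint a
  refine ⟨b, ?_⟩
  rw [hb, conjAdjoint_apply, comp_assoc, comp_assoc, h.isometry]
  rfl

theorem exists_comp_eq_and_adjoint_comp_eq (b : B) :
    ∃ a, σ b ∘L V = V ∘L π a ∧ V† ∘L σ b = π a ∘L V† := by
  obtain ⟨a, ha⟩ := h.exists_comp_eq b
  obtain ⟨a', ha'⟩ := h.exists_comp_eq (star b)
  have hadj := congrArg adjoint ha'
  simp only [adjoint_comp, map_star, star_eq_adjoint, adjoint_adjoint] at hadj
  have haa' : (π a')† = π a :=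
    calc (π a')† = ((π a')† ∘L V†) ∘L V := by rw [comp_assoc, h.isometry]; rfl
      _ = (V† ∘L V) ∘L π a := by rw [← hadj, comp_assoc, ha, comp_assoc]
      _ = π a := by rw [h.isometry]; rfl
  exact ⟨a, ha, by rw [hadj, haa']⟩

theorem comp_adjoint_mem_centralizer : V ∘L V† ∈ Set.centralizer (Set.range σ) := by
  rw [Set.mem_centralizer_iff, Set.forall_mem_range]
  intro b
  obtain ⟨a, ha, ha'⟩ := h.exists_comp_eq_and_adjoint_comp_eq b
  simp only [mul_def]
  rw [← comp_assoc, ha, comp_assoc, comp_assoc, ha']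

theorem comp_adjoint_mem_envelope : V ∘L V† ∈ envelope σ := by
  obtain ⟨b, hb⟩ := h.exists_eq_comp_adjoint
  exact hb ▸ Set.subset_centralizer_centralizer (Set.mem_range_self b)

theorem conjAdjoint_mem_centralizer {D : H →L[ℂ] H} (hD : D ∈ Set.centralizer (Set.range π)) :
    conjAdjoint V D ∈ Set.centralizer (Set.range σ) := by
  rw [Set.mem_centralizer_iff, Set.forall_mem_range] at hD ⊢
  intro b
  obtain ⟨a, ha, ha'⟩ := h.exists_comp_eq_and_adjoint_comp_eq b
  have hDa : π a ∘L D = D ∘L π a := hD a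
  simp only [mul_def, conjAdjoint_apply]
  rw [← comp_assoc, ha, comp_assoc, ← comp_assoc _ D, hDa, comp_assoc, comp_assoc, comp_assoc, ha']

theorem conjAdjoint_adjoint_mem_centralizer {C : K →L[ℂ] K}
    (hC : C ∈ Set.centralizer (Set.range σ)) :
    conjAdjoint (V†) C ∈ Set.centralizer (Set.range π) := by
  rw [Set.mem_centralizer_iff, Set.forall_mem_range] at hC ⊢
  intro a
  obtain ⟨b, hb⟩ := h.exists_eq_conjAdjoint a
  have hCb : V ∘L (π a ∘L V† ∘L C) = C ∘L V ∘L π a ∘L V† := by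
    simpa only [hb, mul_def, conjAdjoint_apply, comp_assoc] using hC b
  calc π a * conjAdjoint (V†) C
      = (V† ∘L V) ∘L (π a ∘L V† ∘L C) ∘L V := by
        rw [h.isometry, conjAdjoint_apply, adjoint_adjoint]; rfl
    _ = V† ∘L (C ∘L V ∘L π a ∘L V†) ∘L V := by rw [← hCb]; simp only [comp_assoc]
    _ = (V† ∘L C ∘L V) ∘L π a ∘L (V† ∘L V) := by simp only [comp_assoc]
    _ = conjAdjoint (V†) C * π a := by
        rw [h.isometry, conjAdjoint_apply, adjoint_adjoint]; rfl

theorem conjAdjoint_mem_envelope_iff {S : H →L[ℂ] H} :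
    conjAdjoint V S ∈ envelope σ ↔ S ∈ envelope π := by
  constructor
  · refine fun hS D hD => conjAdjoint_injective h.isometry ?_
    rw [← conjAdjoint_mul h.isometry, ← conjAdjoint_mul h.isometry]
    exact hS _ (h.conjAdjoint_mem_centralizer hD)
  · intro hS C hC
    have hDS := hS _ (h.conjAdjoint_adjoint_mem_centralizer hC)
    have hee := (isStarProjection_comp_adjoint h.isometry).isIdempotentElem.eq
    have he : C * (V ∘L V†) = (V ∘L V†) * C := h.comp_adjoint_mem_envelope C hC
    have hD : conjAdjoint V (conjAdjoint (V†) C) = C * (V ∘L V†) := by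
      calc conjAdjoint V (conjAdjoint (V†) C) = (V ∘L V†) * C * (V ∘L V†) := by
            simp only [conjAdjoint_apply, adjoint_adjoint, mul_def, comp_assoc]
        _ = C * (V ∘L V†) := by rw [← he, mul_assoc, hee]
    calc C * conjAdjoint V S = C * (V ∘L V†) * conjAdjoint V S := by
          rw [mul_assoc, conjAdjoint_one_mul_conjAdjoint h.isometry]
      _ = conjAdjoint V S * (C * (V ∘L V†)) := by
          rw [← hD, conjAdjoint_mul h.isometry, conjAdjoint_mul h.isometry, hDS]
      _ = conjAdjoint V S * C := by
          rw [he, ← mul_assoc, conjAdjoint_mul_conjAdjoint_one h.isometry]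

theorem isMinimalProjection_conjAdjoint_iff {p : H →L[ℂ] H} :
    IsMinimalProjection σ (conjAdjoint V p) ↔ IsMinimalProjection π p := by
  have hinj := conjAdjoint_injective h.isometry
  have hproj {q : H →L[ℂ] H} := isStarProjection_conjAdjoint_iff h.isometry (p := q)
  constructor
  · refine fun hp => ⟨hproj.1 hp.isStarProjection, h.conjAdjoint_mem_envelope_iff.1 hp.mem, ?_, ?_⟩
    · rintro rfl
      exact hp.ne_zero (map_zero _)
    · intro q hq hq' hqp
      have hmin := hp.minimal _ (h.conjAdjoint_mem_envelope_iff.2 hq) (hproj.2 hq')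
        (conjAdjoint_mono V hqp)
      rwa [map_eq_zero_iff _ hinj, hinj.eq_iff] at hmin
  · refine fun hp => ⟨hproj.2 hp.isStarProjection, h.conjAdjoint_mem_envelope_iff.2 hp.mem,
      (map_ne_zero_iff _ hinj).2 hp.ne_zero, ?_⟩
    intro q hq hq' hqp
    obtain ⟨q, rfl⟩ := exists_eq_conjAdjoint_of_le h.isometry hp.isStarProjection hq' hqp
    rw [map_eq_zero_iff _ hinj, hinj.eq_iff]
    exact hp.minimal q (h.conjAdjoint_mem_envelope_iff.1 hq) (hproj.1 hq')
      ((conjAdjoint_le_conjAdjoint_iff h.isometry).1 hqp)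

theorem comp_adjoint_mul_eq_zero_or_exists {p : K →L[ℂ] K} (hp : IsMinimalProjection σ p) :
    (V ∘L V†) * p = 0 ∨ ∃ q, IsMinimalProjection π q ∧ p = conjAdjoint V q := by
  have he := isStarProjection_comp_adjoint h.isometry
  have hep : Commute (V ∘L V†) p := hp.mem _ h.comp_adjoint_mem_centralizer
  have hep' := he.mul hp.isStarProjection hep
  have hle : (V ∘L V†) * p ≤ p := (hep'.le_iff_mul_eq_left hp.isStarProjection).2 <| by
    rw [mul_assoc, hp.isStarProjection.isIdempotentElem.eq]
  have hmem := Set.mul_mem_centralizer h.comp_adjoint_mem_envelope hp.mem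
  refine (hp.minimal _ hmem hep' hle).imp_right fun heq => ?_
  have hple : p ≤ conjAdjoint V 1 := (hp.isStarProjection.le_iff_mul_eq_right he).2 heq
  obtain ⟨q, rfl⟩ := exists_eq_conjAdjoint_of_le h.isometry (.one _) hp.isStarProjection hple
  exact ⟨q, h.isMinimalProjection_conjAdjoint_iff.1 hp, rfl⟩

theorem conjAdjoint_opTensor_mem_spatialTensor {A' B' H' K' : Type*} [CStarAlgebra A']
    [CStarAlgebra B'] [NormedAddCommGroup H'] [InnerProductSpace ℂ H'] [CompleteSpace H']
    [NormedAddCommGroup K'] [InnerProductSpace ℂ K'] [CompleteSpace K']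
    {σ' : B' →⋆ₐ[ℂ] (K' →L[ℂ] K')} {V' : H' →L[ℂ] K'} {π' : A' →⋆ₐ[ℂ] (H' →L[ℂ] H')}
    (h' : IsSummand σ' V' π') {T : HTensor H H' →L[ℂ] HTensor H H'}
    (hT : T ∈ spatialTensor π π') :
    conjAdjoint (opTensor V V') T ∈ spatialTensor σ σ' := by
  have hiso : (opTensor V V')† ∘L opTensor V V' = 1 := by
    rw [adjoint_opTensor, ← opTensor_comp, h.isometry, h'.isometry, opTensor_one]
  have hgen (a : A) (a' : A') :
      conjAdjoint (opTensor V V') (opTensor (π a) (π' a')) ∈ spatialTensor σ σ' := by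
    obtain ⟨b, hb⟩ := h.exists_eq_conjAdjoint a
    obtain ⟨b', hb'⟩ := h'.exists_eq_conjAdjoint a'
    rw [← opTensor_conjAdjoint, ← hb, ← hb']
    exact opTensor_mem_spatialTensor σ σ' b b'
  have hclosed : IsClosed (spatialTensor σ σ' : Set (HTensor K K' →L[ℂ] HTensor K K')) :=
    StarSubalgebra.isClosed_topologicalClosure _
  refine closure_minimal ?_ (hclosed.preimage (continuous_conjAdjoint (opTensor V V'))) hT
  intro T hT
  rw [Set.mem_preimage, SetLike.mem_coe]
  induction hT using StarAlgebra.adjoin_induction with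
  | mem T hT =>
    obtain ⟨a, a', rfl⟩ := hT
    exact hgen a a'
  | algebraMap c =>
    rw [Algebra.algebraMap_eq_smul_one, ← opTensor_one, ← map_one π, ← map_one π', map_smul]
    exact StarSubalgebra.smul_mem _ (hgen 1 1) c
  | add S T _ _ hS hT => exact map_add (conjAdjoint (opTensor V V')) S T ▸ add_mem hS hT
  | mul S T _ _ hS hT => exact conjAdjoint_mul hiso S T ▸ mul_mem hS hT
  | star T _ hT => exact star_conjAdjoint (opTensor V V') T ▸ star_mem hT

theorem corner_mem_spatialTensor {T : HTensor H H →L[ℂ] HTensor H H}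
    (hT : T ∈ spatialTensor π π) : corner V T ∈ spatialTensor σ σ :=
  h.conjAdjoint_opTensor_mem_spatialTensor h hT

end IsSummand

end Summand

section Isometry

variable {H K : Type*} [NormedAddCommGroup H] [InnerProductSpace ℂ H] [NormedAddCommGroup K]
  [InnerProductSpace ℂ K]

/-- The unitary from a subspace onto its image that a linear isometry restricts to. -/
def submoduleMapEquiv (J : H →ₗᵢ[ℂ] K) (X : Submodule ℂ H) : X ≃ₗᵢ[ℂ] X.map J.toLinearMap where
  toLinearEquiv := Submodule.equivMapOfInjective J.toLinearMap J.injective X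
  norm_map' x := J.norm_map x

theorem coe_submoduleMapEquiv (J : H →ₗᵢ[ℂ] K) (X : Submodule ℂ H) (x : X) :
    (submoduleMapEquiv J X x : K) = J x := rfl

theorem apply_coe_submoduleMapEquiv_symm (J : H →ₗᵢ[ℂ] K) (X : Submodule ℂ H)
    (y : X.map J.toLinearMap) : J ((submoduleMapEquiv J X).symm y) = y := by
  rw [← coe_submoduleMapEquiv, LinearIsometryEquiv.apply_symm_apply]

theorem apply_mem_topologicalClosure {ι : Type*} {X : ι → Submodule ℂ H}
    (hX : (⨆ i, X i).topologicalClosure = ⊤) {S : Submodule ℂ K} (J : H →ₗᵢ[ℂ] K)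
    (hS : ∀ i, (X i).map J.toLinearMap ≤ S) (x : H) : J x ∈ S.topologicalClosure := by
  have hx : x ∈ (⨆ i, X i).topologicalClosure := hX ▸ Submodule.mem_top
  exact map_mem_closure J.continuous hx
    (iSup_le fun i => Submodule.map_le_iff_le_comap.1 (hS i) : ⨆ i, X i ≤ S.comap J.toLinearMap)

end Isometry

section Atomic

variable {A B H K : Type*} [CStarAlgebra A] [CStarAlgebra B]
  [NormedAddCommGroup H] [InnerProductSpace ℂ H] [CompleteSpace H]
  [NormedAddCommGroup K] [InnerProductSpace ℂ K] [CompleteSpace K]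
  {σ : B →⋆ₐ[ℂ] (K →L[ℂ] K)} {V : H →L[ℂ] K} {π : A →⋆ₐ[ℂ] (H →L[ℂ] H)}

theorem not_equivalentSub_of_apply {X Y : Submodule ℂ H} (hX : X ≠ ⊥) (a : A)
    (h₁ : ∀ x ∈ X, π a x = x) (h₀ : ∀ y ∈ Y, π a y = 0) : ¬ EquivalentSub π X Y := by
  rintro ⟨U, hU⟩
  refine hX ((Submodule.eq_bot_iff _).2 fun x hx => ?_)
  have hUx : (U ⟨x, hx⟩ : H) = 0 := (hU a ⟨x, hx⟩ ⟨x, hx⟩ (h₁ x hx).symm).trans (h₀ _ (U _).2)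
  rw [Submodule.coe_eq_zero, map_eq_zero_iff U U.injective] at hUx
  exact congrArg Subtype.val hUx

theorem topologicalClosure_iSup_eq_top_of_isHilbertSum {ι : Type*} {X : ι → Submodule ℂ H}
    (hX : ∀ i, IsClosed (X i : Set H))
    (hsum : IsHilbertSum ℂ (fun i => X i) (fun i => (X i).subtypeₗᵢ)) :
    (⨆ i, X i).topologicalClosure = ⊤ := by
  have : ∀ i, CompleteSpace (X i) := fun i => (hX i).completeSpace_coe
  have hrange := hsum.OrthogonalFamily.range_linearIsometry
  simp only [Submodule.subtypeₗᵢ_toLinearMap, Submodule.range_subtype] at hrange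
  rw [← hrange, LinearMap.range_eq_top]
  exact hsum.surjective_isometry

namespace IsSummand

/-- The embedding of a summand as a bundled linear isometry. -/
def linearIsometry (h : IsSummand σ V π) : H →ₗᵢ[ℂ] K where
  toLinearMap := V.toLinearMap
  norm_map' := (norm_map_iff_adjoint_comp_self V).2 h.isometry

variable (h : IsSummand σ V π)

theorem linearIsometry_apply (x : H) : h.linearIsometry x = V x := rfl

theorem exists_apply_linearIsometry_eq (a : A) :
    ∃ b, ∀ x, σ b (h.linearIsometry x) = h.linearIsometry (π a x) :=
  (h.exists_comp_eq_comp a).imp fun _ hb x => DFunLike.congr_fun hb x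

theorem isIrreducibleSub_map {X : Submodule ℂ H} (hX : IsIrreducibleSub π X) :
    IsIrreducibleSub σ (X.map h.linearIsometry.toLinearMap) where
  isClosed := h.linearIsometry.isometry.isClosedEmbedding.isClosedMap _ hX.isClosed
  invariant := by
    rintro b _ ⟨x, hx, rfl⟩
    obtain ⟨a, ha⟩ := h.exists_comp_eq b
    exact ⟨π a x, hX.invariant a x hx, congr($ha.symm x)⟩
  ne_bot := fun hbot => hX.ne_bot <| Submodule.map_injective_of_injective h.linearIsometry.injective
    (hbot.trans (Submodule.map_bot _).symm)
  irreducible Y hY hinv hle := by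
    have hmap : (Y.comap h.linearIsometry.toLinearMap).map h.linearIsometry.toLinearMap = Y :=
      Submodule.map_comap_eq_self (hle.trans LinearMap.map_le_range)
    have hinv' : IsInvariant π (Y.comap h.linearIsometry.toLinearMap) := fun a x hx => by
      obtain ⟨b, hb⟩ := h.exists_apply_linearIsometry_eq a
      change h.linearIsometry (π a x) ∈ Y
      exact hb x ▸ hinv b _ hx
    have hle' : Y.comap h.linearIsometry.toLinearMap ≤ X :=
      (Submodule.comap_mono hle).trans
        (Submodule.comap_map_eq_of_injective h.linearIsometry.injective X).le
    rw [← hmap]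
    exact (hX.irreducible _ (hY.preimage V.continuous) hinv' hle').imp
      (fun hbot => by rw [hbot, Submodule.map_bot]) (fun heq => by rw [heq])

theorem equivalentSub_of_map {X Y : Submodule ℂ H}
    (hXY : EquivalentSub σ (X.map h.linearIsometry.toLinearMap)
      (Y.map h.linearIsometry.toLinearMap)) : EquivalentSub π X Y := by
  obtain ⟨U, hU⟩ := hXY
  let J := h.linearIsometry
  refine ⟨(submoduleMapEquiv J X).trans (U.trans (submoduleMapEquiv J Y).symm), fun a x y hxy => ?_⟩
  obtain ⟨b, hb⟩ := h.exists_apply_linearIsometry_eq a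
  apply J.injective
  rw [← hb]
  simp only [LinearIsometryEquiv.trans_apply, J, apply_coe_submoduleMapEquiv_symm]
  exact hU b _ _ (by rw [coe_submoduleMapEquiv, coe_submoduleMapEquiv, hb, hxy])

end IsSummand

end Atomic

section DirectSum

variable {A₁ A₂ B H₁ H₂ K : Type*} [CStarAlgebra A₁] [CStarAlgebra A₂] [CStarAlgebra B]
  [NormedAddCommGroup H₁] [InnerProductSpace ℂ H₁] [CompleteSpace H₁]
  [NormedAddCommGroup H₂] [InnerProductSpace ℂ H₂] [CompleteSpace H₂]
  [NormedAddCommGroup K] [InnerProductSpace ℂ K] [CompleteSpace K]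

theorem IsSummand.adjoint_opTensor_apply_mem_orthogonal {σ : B →⋆ₐ[ℂ] (K →L[ℂ] K)}
    {V : H₁ →L[ℂ] K} {π₁ : A₁ →⋆ₐ[ℂ] (H₁ →L[ℂ] H₁)} (h : IsSummand σ V π₁) {x : HTensor K K}
    (hx : x ∈ (diagSubspace σ)ᗮ) : ((opTensor V V)†) x ∈ (diagSubspace π₁)ᗮ := by
  rw [mem_orthogonal_diagSubspace_iff] at hx ⊢
  intro p hp
  have hiso : (opTensor V V)† ∘L opTensor V V = 1 := by
    rw [adjoint_opTensor, ← opTensor_comp, h.isometry, opTensor_one]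
  have hpx := hx _ (h.isMinimalProjection_conjAdjoint_iff.2 hp)
  rw [opTensor_conjAdjoint] at hpx
  calc opTensor p p (((opTensor V V)†) x)
      = ((opTensor V V)† ∘L opTensor V V) (opTensor p p (((opTensor V V)†) x)) := by
        rw [hiso]; rfl
    _ = ((opTensor V V)†) (conjAdjoint (opTensor V V) (opTensor p p) x) := rfl
    _ = 0 := by rw [hpx, map_zero]

/-- The isometries `V` and `W` exhibit `σ` as the direct sum of the representations `π₁` and `π₂`
of two algebras; the algebra on which `σ` is defined acts as their direct sum. -/
structure IsDirectSum (σ : B →⋆ₐ[ℂ] (K →L[ℂ] K)) (V : H₁ →L[ℂ] K) (W : H₂ →L[ℂ] K)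
    (π₁ : A₁ →⋆ₐ[ℂ] (H₁ →L[ℂ] H₁)) (π₂ : A₂ →⋆ₐ[ℂ] (H₂ →L[ℂ] H₂)) : Prop where
  left : IsSummand σ V π₁
  right : IsSummand σ W π₂
  add_eq_one : V ∘L V† + W ∘L W† = 1

variable {σ : B →⋆ₐ[ℂ] (K →L[ℂ] K)} {V : H₁ →L[ℂ] K} {W : H₂ →L[ℂ] K}
  {π₁ : A₁ →⋆ₐ[ℂ] (H₁ →L[ℂ] H₁)} {π₂ : A₂ →⋆ₐ[ℂ] (H₂ →L[ℂ] H₂)}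
  {ρ₁ : HTensor H₁ H₁ →L[ℂ] HTensor H₁ H₁} {ρ₂ : HTensor H₂ H₂ →L[ℂ] HTensor H₂ H₂} {r : ℝ}

theorem IsSplitting.glue_comp_opTensor_conjAdjoint_eq_zero (h : IsSplitting V W)
    (hρ₁ : 0 ≤ ρ₁) (hρ₂ : 0 ≤ ρ₂) (hr : 0 ≤ r) {p : H₁ →L[ℂ] H₁} (hp : ρ₁ ∘L opTensor p p = 0) :
    glue V W ρ₁ ρ₂ r ∘L opTensor (conjAdjoint V p) (conjAdjoint V p) = 0 := by
  rw [opTensor_conjAdjoint, conjAdjoint_apply, ← comp_assoc,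
    h.glue_comp_opTensor_left hρ₁ hρ₂ hr, comp_assoc, ← comp_assoc ρ₁, hp, zero_comp, comp_zero]

namespace IsDirectSum

variable (h : IsDirectSum σ V W π₁ π₂)

include h

theorem symm : IsDirectSum σ W V π₂ π₁ :=
  ⟨h.right, h.left, by rw [add_comm, h.add_eq_one]⟩

theorem isSplitting : IsSplitting V W :=
  ⟨h.left.isometry, h.right.isometry, h.add_eq_one⟩

theorem exists_eq_conjAdjoint_of_isMinimalProjection {p : K →L[ℂ] K}
    (hp : IsMinimalProjection σ p) :
    (∃ q, IsMinimalProjection π₁ q ∧ p = conjAdjoint V q) ∨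
      ∃ q, IsMinimalProjection π₂ q ∧ p = conjAdjoint W q := by
  rcases h.left.comp_adjoint_mul_eq_zero_or_exists hp with hVp | hleft
  · rcases h.right.comp_adjoint_mul_eq_zero_or_exists hp with hWp | hright
    · refine absurd ?_ hp.ne_zero
      rw [← one_mul p, ← h.add_eq_one, add_mul, hVp, hWp, add_zero]
    · exact Or.inr hright
  · exact Or.inl hleft

theorem glue_mem_spatialTensor (h₁ : ρ₁ ∈ spatialTensor π₁ π₁) (h₂ : ρ₂ ∈ spatialTensor π₂ π₂) :
    glue V W ρ₁ ρ₂ r ∈ spatialTensor σ σ := by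
  obtain ⟨b, hb⟩ := h.left.exists_eq_comp_adjoint
  obtain ⟨c, hc⟩ := h.right.exists_eq_comp_adjoint
  rw [glue, ← hb, ← hc]
  exact add_mem (add_mem
    (add_mem (h.left.corner_mem_spatialTensor h₁) (h.right.corner_mem_spatialTensor h₂))
    (StarSubalgebra.smul_mem _ (opTensor_mem_spatialTensor σ σ b c) _))
    (StarSubalgebra.smul_mem _ (opTensor_mem_spatialTensor σ σ c b) _)

theorem glue_mul_diagProj (hρ₁ : 0 ≤ ρ₁) (hρ₂ : 0 ≤ ρ₂) (hr : 0 ≤ r)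
    (hd₁ : ρ₁ * diagProj π₁ = 0) (hd₂ : ρ₂ * diagProj π₂ = 0) :
    glue V W ρ₁ ρ₂ r * diagProj σ = 0 := by
  rw [mul_diagProj_eq_zero_iff] at hd₁ hd₂ ⊢
  intro p hp
  rcases h.exists_eq_conjAdjoint_of_isMinimalProjection hp with ⟨q, hq, rfl⟩ | ⟨q, hq, rfl⟩
  · exact h.isSplitting.glue_comp_opTensor_conjAdjoint_eq_zero hρ₁ hρ₂ hr (hd₁ q hq)
  · rw [glue_comm]
    exact h.symm.isSplitting.glue_comp_opTensor_conjAdjoint_eq_zero hρ₂ hρ₁ hr (hd₂ q hq)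

theorem eq_zero_of_glue_apply_eq_zero
    (h₁ : ∀ x ∈ (diagSubspace π₁)ᗮ, ρ₁ x = 0 → x = 0)
    (h₂ : ∀ x ∈ (diagSubspace π₂)ᗮ, ρ₂ x = 0 → x = 0) (hr : r ≠ 0) {x : HTensor K K}
    (hx : x ∈ (diagSubspace σ)ᗮ) (hx₀ : glue V W ρ₁ ρ₂ r x = 0) : x = 0 := by
  have hs := h.isSplitting
  have hr' : (r : ℂ) ≠ 0 := Complex.ofReal_ne_zero.2 hr
  have hx₀' : glue W V ρ₂ ρ₁ r x = 0 := by rwa [glue_comm]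
  refine hs.eq_zero_of_adjoint_opTensor_apply_eq_zero
    (h₁ _ (h.left.adjoint_opTensor_apply_mem_orthogonal hx) ?_) ((smul_eq_zero_iff_right hr').1 ?_)
    ((smul_eq_zero_iff_right hr').1 ?_) (h₂ _ (h.right.adjoint_opTensor_apply_mem_orthogonal hx) ?_)
  · rw [← comp_apply, ← hs.adjoint_opTensor_left_comp_glue (ρ₂ := ρ₂) (r := r), comp_apply, hx₀,
      map_zero]
  · rw [← smul_apply, ← hs.adjoint_opTensor_mixed_comp_glue (ρ₁ := ρ₁) (ρ₂ := ρ₂), comp_apply,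
      hx₀, map_zero]
  · rw [← smul_apply, ← hs.symm.adjoint_opTensor_mixed_comp_glue (ρ₁ := ρ₂) (ρ₂ := ρ₁),
      comp_apply, hx₀', map_zero]
  · rw [← comp_apply, ← hs.symm.adjoint_opTensor_left_comp_glue (ρ₂ := ρ₁) (r := r), comp_apply,
      hx₀', map_zero]

theorem isQuantumMetric_glue (h₁ : IsQuantumMetric π₁ ρ₁) (h₂ : IsQuantumMetric π₂ ρ₂)
    (hr₁ : ‖ρ₁‖ ≤ 2 * r) (hr₂ : ‖ρ₂‖ ≤ 2 * r) (hr : 0 < r) :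
    IsQuantumMetric σ (glue V W ρ₁ ρ₂ r) := by
  have hnonneg : 0 ≤ glue V W ρ₁ ρ₂ r := glue_nonneg h₁.nonneg h₂.nonneg hr.le
  have hdiag := h.glue_mul_diagProj h₁.nonneg h₂.nonneg hr.le h₁.mul_diag h₂.mul_diag
  exact {
    mem := h.glue_mem_spatialTensor h₁.mem h₂.mem
    nonneg := hnonneg
    mul_diag := hdiag
    diag_mul := by
      rw [← star_eq_zero, star_mul, (IsSelfAdjoint.of_nonneg hnonneg).star_eq,
        (diagProj_isLeast σ).1.1.isSelfAdjoint.star_eq, hdiag]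
    eq_zero_of_apply_eq_zero := fun x => h.eq_zero_of_glue_apply_eq_zero
      h₁.eq_zero_of_apply_eq_zero h₂.eq_zero_of_apply_eq_zero hr.ne'
    flip_eq := flip_glue h₁.flip_eq h₂.flip_eq
    triangle := h.isSplitting.midOne_glue_le h₁.nonneg h₂.nonneg h₁.triangle h₂.triangle hr₁ hr₂ }

theorem inner_linearIsometry_linearIsometry (x : H₁) (y : H₂) :
    inner ℂ (h.left.linearIsometry x) (h.right.linearIsometry y) = 0 := by
  rw [IsSummand.linearIsometry_apply, IsSummand.linearIsometry_apply, ← adjoint_inner_right,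
    ← comp_apply, h.isSplitting.adjoint_comp_eq_zero, zero_apply, inner_zero_right]

theorem not_equivalentSub_map_map {X : Submodule ℂ H₁} (Y : Submodule ℂ H₂)
    (hX : X.map h.left.linearIsometry.toLinearMap ≠ ⊥) :
    ¬ EquivalentSub σ (X.map h.left.linearIsometry.toLinearMap)
      (Y.map h.right.linearIsometry.toLinearMap) := by
  obtain ⟨b, hb⟩ := h.left.exists_eq_comp_adjoint
  refine not_equivalentSub_of_apply hX b ?_ ?_
  · rintro _ ⟨x, -, rfl⟩
    rw [hb]
    exact congr(V ($h.left.isometry x))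
  · rintro _ ⟨y, -, rfl⟩
    rw [hb]
    exact (congr(V ($h.isSplitting.adjoint_comp_eq_zero y))).trans (map_zero V)

/-- The images in the direct sum of families of subspaces of both summands. -/
def sumMap {ι₁ ι₂ : Type*} (h : IsDirectSum σ V W π₁ π₂) (X : ι₁ → Submodule ℂ H₁)
    (Y : ι₂ → Submodule ℂ H₂) : ι₁ ⊕ ι₂ → Submodule ℂ K :=
  Sum.elim (fun i => (X i).map h.left.linearIsometry.toLinearMap)
    (fun j => (Y j).map h.right.linearIsometry.toLinearMap)

theorem orthogonalFamily_sumMap {ι₁ ι₂ : Type*} {X : ι₁ → Submodule ℂ H₁}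
    {Y : ι₂ → Submodule ℂ H₂} (hX : OrthogonalFamily ℂ (fun i => X i) fun i => (X i).subtypeₗᵢ)
    (hY : OrthogonalFamily ℂ (fun i => Y i) fun i => (Y i).subtypeₗᵢ) :
    OrthogonalFamily ℂ (fun i => h.sumMap X Y i) fun i => (h.sumMap X Y i).subtypeₗᵢ := by
  rintro (i | i) (j | j) hij ⟨_, x, hx, rfl⟩ ⟨_, y, hy, rfl⟩
  · exact (h.left.linearIsometry.inner_map_map x y).trans
      (hX (ne_of_apply_ne Sum.inl hij) ⟨x, hx⟩ ⟨y, hy⟩)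
  · exact h.inner_linearIsometry_linearIsometry x y
  · exact h.symm.inner_linearIsometry_linearIsometry x y
  · exact (h.right.linearIsometry.inner_map_map x y).trans
      (hY (ne_of_apply_ne Sum.inr hij) ⟨x, hx⟩ ⟨y, hy⟩)

theorem topologicalClosure_iSup_sumMap_eq_top {ι₁ ι₂ : Type*} {X : ι₁ → Submodule ℂ H₁}
    {Y : ι₂ → Submodule ℂ H₂} (hX : (⨆ i, X i).topologicalClosure = ⊤)
    (hY : (⨆ i, Y i).topologicalClosure = ⊤) :
    (⨆ i, h.sumMap X Y i).topologicalClosure = ⊤ := by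
  rw [Submodule.eq_top_iff']
  intro z
  have hz : z = V ((V†) z) + W ((W†) z) := congr($h.add_eq_one.symm z)
  rw [hz]
  exact add_mem
    (apply_mem_topologicalClosure hX h.left.linearIsometry
      (fun i => le_iSup (h.sumMap X Y) (Sum.inl i)) _)
    (apply_mem_topologicalClosure hY h.right.linearIsometry
      (fun j => le_iSup (h.sumMap X Y) (Sum.inr j)) _)

theorem isHilbertSum_sumMap {ι₁ ι₂ : Type*} {X : ι₁ → Submodule ℂ H₁} {Y : ι₂ → Submodule ℂ H₂}
    (hX : ∀ i, IsIrreducibleSub π₁ (X i)) (hY : ∀ i, IsIrreducibleSub π₂ (Y i))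
    (hX' : IsHilbertSum ℂ (fun i => X i) fun i => (X i).subtypeₗᵢ)
    (hY' : IsHilbertSum ℂ (fun i => Y i) fun i => (Y i).subtypeₗᵢ) :
    IsHilbertSum ℂ (fun i => h.sumMap X Y i) fun i => (h.sumMap X Y i).subtypeₗᵢ := by
  have : ∀ i, CompleteSpace (h.sumMap X Y i) := by
    rintro (i | i)
    · exact (h.left.isIrreducibleSub_map (hX i)).isClosed.completeSpace_coe
    · exact (h.right.isIrreducibleSub_map (hY i)).isClosed.completeSpace_coe
  refine IsHilbertSum.mkInternal _
    (h.orthogonalFamily_sumMap hX'.OrthogonalFamily hY'.OrthogonalFamily)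
    (h.topologicalClosure_iSup_sumMap_eq_top ?_ ?_).ge
  · exact topologicalClosure_iSup_eq_top_of_isHilbertSum (fun i => (hX i).isClosed) hX'
  · exact topologicalClosure_iSup_eq_top_of_isHilbertSum (fun i => (hY i).isClosed) hY'

end IsDirectSum

end DirectSum

theorem IsDirectSum.isAtomic.{v₁, v₂} {A₁ A₂ B : Type*} {H₁ : Type v₁} {H₂ : Type v₂}
    {K : Type max v₁ v₂} [CStarAlgebra A₁] [CStarAlgebra A₂] [CStarAlgebra B]
    [NormedAddCommGroup H₁] [InnerProductSpace ℂ H₁] [CompleteSpace H₁]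
    [NormedAddCommGroup H₂] [InnerProductSpace ℂ H₂] [CompleteSpace H₂]
    [NormedAddCommGroup K] [InnerProductSpace ℂ K] [CompleteSpace K]
    {σ : B →⋆ₐ[ℂ] (K →L[ℂ] K)} {V : H₁ →L[ℂ] K} {W : H₂ →L[ℂ] K}
    {π₁ : A₁ →⋆ₐ[ℂ] (H₁ →L[ℂ] H₁)} {π₂ : A₂ →⋆ₐ[ℂ] (H₂ →L[ℂ] H₂)}
    (h : IsDirectSum σ V W π₁ π₂) (h₁ : IsAtomic π₁) (h₂ : IsAtomic π₂) : IsAtomic σ := by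
  obtain ⟨ι₁, X, hX, hirrX, hneX⟩ := h₁
  obtain ⟨ι₂, Y, hY, hirrY, hneY⟩ := h₂
  have hirrX' i := h.left.isIrreducibleSub_map (hirrX i)
  have hirrY' j := h.right.isIrreducibleSub_map (hirrY j)
  refine ⟨ι₁ ⊕ ι₂, h.sumMap X Y, h.isHilbertSum_sumMap hirrX hirrY hX hY,
    Sum.rec hirrX' hirrY', ?_⟩
  rintro (i | i) (j | j) hij
  · exact mt h.left.equivalentSub_of_map (hneX (ne_of_apply_ne Sum.inl hij))
  · exact h.not_equivalentSub_map_map (Y j) (hirrX' i).ne_bot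
  · exact h.symm.not_equivalentSub_map_map (X j) (hirrY' i).ne_bot
  · exact mt h.right.equivalentSub_of_map (hneY (ne_of_apply_ne Sum.inr hij))

section RepSum

variable {H₁ H₂ : Type*} [NormedAddCommGroup H₁] [InnerProductSpace ℂ H₁]
  [NormedAddCommGroup H₂] [InnerProductSpace ℂ H₂]

theorem inl_fst_add_inr_snd (x : HSum H₁ H₂) : inl H₁ H₂ x.fst + inr H₁ H₂ x.snd = x :=
  WithLp.ofLp_injective 2 <| Prod.ext (add_zero x.fst) (zero_add x.snd)

variable {A₁ A₂ : Type*} [CStarAlgebra A₁] [CStarAlgebra A₂] [CompleteSpace H₁] [CompleteSpace H₂]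
  {π₁ : A₁ →⋆ₐ[ℂ] (H₁ →L[ℂ] H₁)} {π₂ : A₂ →⋆ₐ[ℂ] (H₂ →L[ℂ] H₂)}

theorem repSum_apply_inl (a : A₁ × A₂) (x : H₁) :
    repSum π₁ π₂ a (inl H₁ H₂ x) = inl H₁ H₂ (π₁ a.1 x) :=
  congr(WithLp.toLp 2 (π₁ a.1 x, $(map_zero (π₂ a.2))))

theorem repSum_apply_inr (a : A₁ × A₂) (x : H₂) :
    repSum π₁ π₂ a (inr H₁ H₂ x) = inr H₁ H₂ (π₂ a.2 x) :=
  congr(WithLp.toLp 2 ($(map_zero (π₁ a.1)), π₂ a.2 x))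

theorem adjoint_inl_comp_inl : (inl H₁ H₂)† ∘L inl H₁ H₂ = 1 :=
  ContinuousLinearMap.ext fun x => adjoint_inl_apply (inl H₁ H₂ x)

theorem adjoint_inr_comp_inr : (inr H₁ H₂)† ∘L inr H₁ H₂ = 1 :=
  ContinuousLinearMap.ext fun x => adjoint_inr_apply (inr H₁ H₂ x)

theorem inl_comp_adjoint_add_inr_comp_adjoint :
    inl H₁ H₂ ∘L (inl H₁ H₂)† + inr H₁ H₂ ∘L (inr H₁ H₂)† = 1 := by
  refine ContinuousLinearMap.ext fun x => ?_
  rw [add_apply, comp_apply, comp_apply, adjoint_inl_apply, adjoint_inr_apply, inl_fst_add_inr_snd]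
  rfl

theorem repSum_mk_zero (a : A₁) : repSum π₁ π₂ (a, 0) = conjAdjoint (inl H₁ H₂) (π₁ a) := by
  refine ContinuousLinearMap.ext fun x => ?_
  rw [← inl_fst_add_inr_snd x, map_add, repSum_apply_inl, repSum_apply_inr, map_zero, zero_apply,
    map_zero, add_zero, inl_fst_add_inr_snd, conjAdjoint_apply, comp_apply, comp_apply,
    adjoint_inl_apply]

theorem repSum_zero_mk (a : A₂) : repSum π₁ π₂ (0, a) = conjAdjoint (inr H₁ H₂) (π₂ a) := by
  refine ContinuousLinearMap.ext fun x => ?_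
  rw [← inl_fst_add_inr_snd x, map_add, repSum_apply_inl, repSum_apply_inr, map_zero, zero_apply,
    map_zero, zero_add, inl_fst_add_inr_snd, conjAdjoint_apply, comp_apply, comp_apply,
    adjoint_inr_apply]

theorem repSum_injective (h₁ : Function.Injective π₁) (h₂ : Function.Injective π₂) :
    Function.Injective (repSum π₁ π₂) := by
  intro a b hab
  have hfst : π₁ a.1 = π₁ b.1 :=
    ContinuousLinearMap.ext fun x => congr(($hab (inl H₁ H₂ x)).fst)
  have hsnd : π₂ a.2 = π₂ b.2 :=
    ContinuousLinearMap.ext fun x => congr(($hab (inr H₁ H₂ x)).snd)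
  exact Prod.ext (h₁ hfst) (h₂ hsnd)

variable (π₁ π₂)

theorem isDirectSum_repSum : IsDirectSum (repSum π₁ π₂) (inl H₁ H₂) (inr H₁ H₂) π₁ π₂ where
  left := ⟨adjoint_inl_comp_inl, fun a => ⟨(a, 0), repSum_mk_zero a⟩,
    fun b => ⟨b.1, ContinuousLinearMap.ext (repSum_apply_inl b)⟩⟩
  right := ⟨adjoint_inr_comp_inr, fun a => ⟨(0, a), repSum_zero_mk a⟩,
    fun b => ⟨b.2, ContinuousLinearMap.ext (repSum_apply_inr b)⟩⟩
  add_eq_one := inl_comp_adjoint_add_inr_comp_adjoint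

theorem sumMetric_eq_glue (ρ₁ : HTensor H₁ H₁ →L[ℂ] HTensor H₁ H₁)
    (ρ₂ : HTensor H₂ H₂ →L[ℂ] HTensor H₂ H₂) (r : ℝ) :
    sumMetric π₁ π₂ ρ₁ ρ₂ r = glue (inl H₁ H₂) (inr H₁ H₂) ρ₁ ρ₂ r := by
  rw [sumMetric, glue, repSum_mk_zero, repSum_zero_mk, map_one π₁, map_one π₂, conjAdjoint_one,
    conjAdjoint_one]

end RepSum

end QuantumMetric

end

theorem theorem3 {A₁ A₂ H₁ H₂ : Type*} [CStarAlgebra A₁] [CStarAlgebra A₂]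
    [NormedAddCommGroup H₁] [InnerProductSpace ℂ H₁] [CompleteSpace H₁]
    [NormedAddCommGroup H₂] [InnerProductSpace ℂ H₂] [CompleteSpace H₂]
    (π₁ : A₁ →⋆ₐ[ℂ] (H₁ →L[ℂ] H₁)) (π₂ : A₂ →⋆ₐ[ℂ] (H₂ →L[ℂ] H₂))
    (ρ₁ : QuantumMetric.HTensor H₁ H₁ →L[ℂ] QuantumMetric.HTensor H₁ H₁)
    (ρ₂ : QuantumMetric.HTensor H₂ H₂ →L[ℂ] QuantumMetric.HTensor H₂ H₂)
    (h₁ : QuantumMetric.IsCompactQuantumMetricSpace A₁ ρ₁ π₁)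
    (h₂ : QuantumMetric.IsCompactQuantumMetricSpace A₂ ρ₂ π₂)
    (r : ℝ) (hr : 2⁻¹ * max ‖ρ₁‖ ‖ρ₂‖ ≤ r) (hr₀ : 0 < r) :
    QuantumMetric.IsCompactQuantumMetricSpace (A₁ × A₂)
      (QuantumMetric.sumMetric π₁ π₂ ρ₁ ρ₂ r) (QuantumMetric.repSum π₁ π₂) := by
  have hr₁ : ‖ρ₁‖ ≤ 2 * r := by linarith [le_max_left ‖ρ₁‖ ‖ρ₂‖]
  have hr₂ : ‖ρ₂‖ ≤ 2 * r := by linarith [le_max_right ‖ρ₁‖ ‖ρ₂‖]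
  have hsum := QuantumMetric.isDirectSum_repSum π₁ π₂
  rw [QuantumMetric.sumMetric_eq_glue]
  exact {
    faithful := QuantumMetric.repSum_injective h₁.faithful h₂.faithful
    atomic := hsum.isAtomic h₁.atomic h₂.atomic
    isQuantumMetric :=
      hsum.isQuantumMetric_glue h₁.isQuantumMetric h₂.isQuantumMetric hr₁ hr₂ hr₀ }
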